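/- Let $\epsilon_0>0$, let $\Delta_{\epsilon_0}=\{z\in\mathbb C\colon |z|<\epsilon_0\}$, and let $P\colon\Delta_{\epsilon_0}\to\mathbb R$ be a $\mathcal C^\infty$-smooth function. Put $$M_P=\{(z_1,z_2)\in\mathbb C\times\Delta_{\epsilon_0}\colon \mathrm{Re}\,z_1+P(z_2)=0\},\qquad S_\infty(P)=\{z\in\Delta_{\epsilon_0}\colon \nu_z(P)=+\infty\},$$ where $\nu_z(P)$ is the vanishing order of $\zeta\mapsto P(z+\zeta)-P(z)$ at $\zeta=0$. Assume that (i) $P$ is not rotationally symmetricable, i.e. there is no conformal map $\varphi$ defined near $0\in\mathbb C$ with $\varphi(0)=0$ such that $P(\varphi(z))=P(\varphi(|z|))$ for all $z$ near $0$; (ii) the connected component of $0$ in the zero set $\{z\in\Delta_{\epsilon_0}\colon P(z)=0\}$ is $\{0\}$ (in particular $P(0)=0$); (iii) the connected component of $0$ in $S_\infty(P)$ is $\{0\}$ (in particular $0\in S_\infty(P)$, so $P$ vanishes to infinite order at $0$). Let $\mathrm{Aut}(M_P,0)$ be the set of germs at $0$ of biholomorphisms of $\mathbb C^2$ that fix $0$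 and map the germ of $M_P$ at $0$ into itself, and let $\mathrm G_2(M_P,0)$ be the set of germs at $0$ of the maps $(z_1,z_2)\mapsto(z_1,g(z_2))$, where $g$ is holomorphic in a neighbourhood of $0\in\mathbb C$ with $g(0)=0$, $|g'(0)|=1$ and $P(g(z))=P(z)$ for all $z$ near $0$. Then $$\mathrm{Aut}(M_P,0)=\mathrm G_2(M_P,0).$$ -/

import Mathlib

open Topology Filter
open scoped ContDiff

namespace InfiniteTypeModel

/-- The vanishing order at `a` of a (smooth) function `f`: the least order of a nonzero
derivative of `f` at `a` (the function itself having order `0`), and `⊤` if all of them vanish. -/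
noncomputable def vanishingOrder (f : ℂ → ℝ) (a : ℂ) : ℕ∞ :=
  sInf {k : ℕ∞ | ∃ n : ℕ, k = n ∧ iteratedFDeriv ℝ n f a ≠ 0}

/-- `ν_z(P)`: the vanishing order of `ζ ↦ P (z + ζ) - P z` at `ζ = 0`. -/
noncomputable def nu (P : ℂ → ℝ) (z : ℂ) : ℕ∞ :=
  vanishingOrder (fun ζ => P (z + ζ) - P z) 0

/-- `S_∞(P)`, for `P` defined on the disc of radius `ε` about `0`. -/
def SInf (ε : ℝ) (P : ℂ → ℝ) : Set ℂ :=
  {z | z ∈ Metric.ball (0 : ℂ) ε ∧ nu P z = ⊤}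

/-- The zero set of `P`, for `P` defined on the disc of radius `ε` about `0`. -/
def zeroSet (ε : ℝ) (P : ℂ → ℝ) : Set ℂ :=
  {z | z ∈ Metric.ball (0 : ℂ) ε ∧ P z = 0}

/-- The hypersurface `M_P = {Re z₁ + P(z₂) = 0}`, for `P` defined on the disc of radius `ε`. -/
def model (ε : ℝ) (P : ℂ → ℝ) : Set (ℂ × ℂ) :=
  {p | p.2 ∈ Metric.ball (0 : ℂ) ε ∧ p.1.re + P p.2 = 0}

/-- `P` is rotationally symmetricable: for some germ `φ` at `0` of a conformal map of `ℂ` with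
`φ 0 = 0`, one has `P (φ z) = P (φ |z|)` for all `z` near `0`. -/
def RotationallySymmetricable (P : ℂ → ℝ) : Prop :=
  ∃ φ : ℂ → ℂ, AnalyticAt ℂ φ 0 ∧ φ 0 = 0 ∧ deriv φ 0 ≠ 0 ∧
    ∀ᶠ z in 𝓝 (0 : ℂ), P (φ z) = P (φ ((‖z‖ : ℝ) : ℂ))

/-- `f` agrees near `0` with a biholomorphism from an open neighbourhood of `0` in `ℂ²` onto an
open subset of `ℂ²`. -/
def IsBiholomorphicNearZero (f : ℂ × ℂ → ℂ × ℂ) : Prop :=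
  ∃ e : OpenPartialHomeomorph (ℂ × ℂ) (ℂ × ℂ), (0 : ℂ × ℂ) ∈ e.source ∧
    DifferentiableOn ℂ e e.source ∧ DifferentiableOn ℂ e.symm e.target ∧
    f =ᶠ[𝓝 0] e

/-- The stability group `Aut(M, 0)`: the germs at `0` of biholomorphisms of `ℂ²` which fix `0`
and map (the germ at `0` of) `M` into itself. -/
def stabilityGroup (M : Set (ℂ × ℂ)) : Set (Germ (𝓝 (0 : ℂ × ℂ)) (ℂ × ℂ)) :=
  {F | ∃ f : ℂ × ℂ → ℂ × ℂ, F = (f : Germ (𝓝 (0 : ℂ × ℂ)) (ℂ × ℂ)) ∧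
    f 0 = 0 ∧ IsBiholomorphicNearZero f ∧ ∀ᶠ p in 𝓝 (0 : ℂ × ℂ), p ∈ M → f p ∈ M}

/-- `G₂(M_P, 0)`: the germs at `0` of the maps `(z₁, z₂) ↦ (z₁, g z₂)`, with `g` holomorphic near
`0`, `g 0 = 0`, `|g' 0| = 1` and `P (g z) = P z` for all `z` near `0`. -/
def G₂ (P : ℂ → ℝ) : Set (Germ (𝓝 (0 : ℂ × ℂ)) (ℂ × ℂ)) :=
  {F | ∃ g : ℂ → ℂ, AnalyticAt ℂ g 0 ∧ g 0 = 0 ∧ ‖deriv g 0‖ = 1 ∧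
    (∀ᶠ z in 𝓝 (0 : ℂ), P (g z) = P z) ∧
    F = ((fun p : ℂ × ℂ => (p.1, g p.2)) : Germ (𝓝 (0 : ℂ × ℂ)) (ℂ × ℂ))}

end InfiniteTypeModel

/-!
Germs of automorphisms of the hypersurface `M = {Re z₁ + P z₂ = 0}` at a point of infinite type.

Every map in `G₂` is an automorphism by the inverse function theorem
(`G₂_subset_stabilityGroup`). Conversely, let `F` be an automorphism. The translation field
`(i, 0)` is tangent to `M`, so its pullback `Y = (DF)⁻¹ (i, 0)` is a holomorphic vector field tangent
to `M`. The main point is that `Y = (i c, 0)` for a real constant `c` (`FlatModel.tangent_rigidity`).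

Since `P` is flat at `0`, restricting the tangency relation to `z₁ = i t - P z₂` shows that
`Re Y₁ (i t, ·)` is flat; hence `Y₁` depends on `z₁` only, and to infinite order
`dP (Y₂ (i t, z)) = μ P z` with `μ = Re Y₁' (i t)`. The planar fields `H` along which `P` changes at
such a constant logarithmic rate are very restricted (`FlatModel.logTangent_rigidity`). If
`H 0 ≠ 0`, then `P` vanishes on the integral curve through `0`; along curves tending exponentially to
`0`, and along the curves in a petal of a degenerate zero, `P` cannot decay as fast as flatness or
continuity at `0` demands unless it vanishes; and around a centre the curves are closed, so that
`μ = 0`. Hence always `μ = 0`, and `H` is zero or has a centre. Consequently `Y₁` is an imaginary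
constant, and the slices of `Y₂`, of which every real combination is again of this kind, are real
multiples of a single field: `Y₂ (z₁, z₂) = h z₁ * H z₂`. If `H` had a centre, then on the level
`P = Q` the function `P` would be constant on the integral curves of the holomorphic field
`h (-Q) H`, which are spirals or circles in a linearizing coordinate. A spiral would tend to `0`,
where `P = 0`, so that `Q = 0`; but for `Q = 0` the curves are circles. Hence they always are, and `P`
is rotationally symmetricable (`FlatModel.rotationallySymmetricable_of_center`), which is excluded.

It follows that `F = (z₁ / c + a z₂, g z₂)`. Since `Re a` is flat, `a = 0`, and so `P ∘ g = c⁻¹ P`.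
It remains to see that a conformal germ `g` with `P ∘ g = c P` has `|g' 0| = 1` and `c = 1`
(`FlatModel.eq_one_of_comp_eq_mul`). If `|g' 0| ≠ 1`, iterating `g` or its inverse contradicts
flatness. If `|c| < 1`, then `g` maps the component of `0` in a small set `{|P| ≤ δ}` into its
interior and so is a contraction by Cauchy's estimates. If `c = -1`, let `K` be a small compact
connected neighbourhood of `0` on whose boundary `P` has no zeros, with its holes filled. The plane
is unicoherent, so the boundary of `K` is connected and `P` has constant sign on it, and the opposite
sign on the boundary of `g K`. Thus the two boundaries are disjoint, `K` and `g K` are nested, and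
`g` or its inverse is again a contraction.
-/


namespace InfiniteTypeModel

/-! ### Flat functions -/

/-- `f` vanishes to infinite order at `0`. -/
def Flat {E : Type*} [NormedAddCommGroup E] (f : ℂ → E) : Prop :=
  ∀ N : ℕ, f =O[𝓝 0] fun z : ℂ => ‖z‖ ^ N

/-- The order of flatness is gained one derivative at a time, by the mean value inequality. -/
lemma isBigO_pow_of_fderiv {E : Type*} [NormedAddCommGroup E] [NormedSpace ℝ E] {f : ℂ → E}
    {N : ℕ} (hd : ∀ᶠ z in 𝓝 (0 : ℂ), DifferentiableAt ℝ f z) (h0 : f 0 = 0)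
    (hf : fderiv ℝ f =O[𝓝 0] fun z : ℂ => ‖z‖ ^ N) : f =O[𝓝 0] fun z : ℂ => ‖z‖ ^ (N + 1) := by
  obtain ⟨C, hC⟩ := hf.bound
  obtain ⟨r, hr, hball⟩ := Metric.eventually_nhds_iff_ball.1 (hd.and hC)
  refine Asymptotics.IsBigO.of_bound C ?_
  filter_upwards [Metric.ball_mem_nhds (0 : ℂ) hr] with z hz
  have hz' : ‖z‖ < r := by simpa using hz
  have key := (convex_closedBall (0 : ℂ) ‖z‖).norm_image_sub_le_of_norm_fderiv_le (𝕜 := ℝ) (f := f)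
    (C := C * ‖z‖ ^ N) (x := 0) (y := z) (fun x hx => ?_) (fun x hx => ?_) (by simp) (by simp)
  · rw [h0, sub_zero, sub_zero] at key
    rw [norm_pow, norm_norm, pow_succ, ← mul_assoc]
    exact key
  · have hx' : ‖x‖ ≤ ‖z‖ := by simpa using hx
    exact (hball x (by simpa using hx'.trans_lt hz')).1
  · have hx' : ‖x‖ ≤ ‖z‖ := by simpa using hx
    have h1 := (hball x (by simpa using hx'.trans_lt hz')).2
    have h2 := (hball z hz).2
    rw [norm_pow, norm_norm] at h1 h2
    by_cases hCn : 0 ≤ C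
    · exact h1.trans (by gcongr)
    · have h3 : C * ‖x‖ ^ N ≤ 0 := mul_nonpos_of_nonpos_of_nonneg (by linarith) (by positivity)
      have h4 := (norm_nonneg _).trans h1
      have h5 : ‖x‖ ^ N = 0 := by
        rcases mul_eq_zero.1 (le_antisymm h3 h4) with h | h
        · exact absurd h.ge hCn
        · exact h
      have h6 : C * ‖z‖ ^ N = 0 :=
        le_antisymm (mul_nonpos_of_nonpos_of_nonneg (by linarith) (by positivity))
          ((norm_nonneg _).trans h2)
      rw [h6]; rwa [h5, mul_zero] at h1

/-- A smooth function all of whose derivatives vanish at `0` is flat there. -/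
lemma isBigO_pow_of_iteratedFDeriv_eq_zero (N : ℕ) : ∀ {E : Type} [NormedAddCommGroup E]
    [NormedSpace ℝ E] {f : ℂ → E} {U : Set ℂ} (_ : IsOpen U) (_ : (0 : ℂ) ∈ U)
    (_ : ContDiffOn ℝ ∞ f U) (_ : ∀ n : ℕ, iteratedFDeriv ℝ n f 0 = 0),
    f =O[𝓝 0] fun z : ℂ => ‖z‖ ^ N := by
  induction N with
  | zero =>
    intro E _ _ f U hU h0 hf _
    simpa using (hf.continuousOn.continuousAt (hU.mem_nhds h0)).isBigO_one ℝ
  | succ N ih =>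
    intro E _ _ f U hU h0 hf hz
    refine isBigO_pow_of_fderiv ?_ ?_ (ih hU h0 (hf.fderiv_of_isOpen hU (m := ∞) (by simp)) ?_)
    · filter_upwards [hU.mem_nhds h0] with z hz
      exact (hf.contDiffAt (hU.mem_nhds hz)).differentiableAt (by simp)
    · have := congrArg (fun m => m 0) (hz 0)
      simpa using this
    · intro n
      rw [← norm_eq_zero, norm_iteratedFDeriv_fderiv, hz, norm_zero]

lemma Flat.comp_isBigO {E : Type*} [NormedAddCommGroup E] {f : ℂ → E} (hf : Flat f) {g : ℂ → ℂ}
    (hg : Tendsto g (𝓝 0) (𝓝 0)) (hO : g =O[𝓝 0] fun z : ℂ => z) : Flat fun z => f (g z) := by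
  intro N
  refine ((hf N).comp_tendsto hg).trans ?_
  exact (hO.norm_norm.pow N)

lemma Flat.apply_zero {E : Type*} [NormedAddCommGroup E] {f : ℂ → E} (hf : Flat f) : f 0 = 0 := by
  obtain ⟨C, hC⟩ := (hf 1).bound
  simpa using hC.self_of_nhds

lemma Flat.tendsto {E : Type*} [NormedAddCommGroup E] {f : ℂ → E} (hf : Flat f) :
    Tendsto f (𝓝 0) (𝓝 0) := by
  refine (hf 1).trans_tendsto ?_
  have : Tendsto (fun z : ℂ => ‖z‖ ^ 1) (𝓝 0) (𝓝 (‖(0:ℂ)‖ ^ 1)) :=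
    (continuous_norm.pow 1).tendsto 0
  simpa using this

/-- A holomorphic function with flat real part is constant: its leading term `a z ^ n` has real part
`‖a‖ ‖z‖ ^ n` along a suitable ray. -/
lemma eventually_eq_of_flat_re {u : ℂ → ℂ} (hu : AnalyticAt ℂ u 0) (hf : Flat fun z => (u z).re) :
    (u 0).re = 0 ∧ ∀ᶠ z in 𝓝 (0 : ℂ), u z = u 0 := by
  refine ⟨hf.apply_zero, ?_⟩
  have h0 : (u 0).re = 0 := hf.apply_zero
  have han : AnalyticAt ℂ (fun z => u z - u 0) 0 := hu.sub analyticAt_const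
  rcases eq_or_ne (analyticOrderAt (fun z => u z - u 0) 0) ⊤ with htop | htop
  · filter_upwards [analyticOrderAt_eq_top.1 htop] with z hz
    exact sub_eq_zero.1 hz
  exfalso
  obtain ⟨n, hn⟩ := ENat.ne_top_iff_exists.1 htop
  obtain ⟨v, hv, hv0, hev⟩ := (han.analyticOrderAt_eq_natCast (n := n)).1 hn.symm
  have hn0 : n ≠ 0 := by
    rintro rfl
    have := hev.self_of_nhds
    simp at this
    exact hv0 this.symm
  -- a direction `ξ` with `ξ ^ n * v 0 = ‖v 0‖`
  obtain ⟨ξ, hξ⟩ : ∃ ξ : ℂ, ξ ^ n = ‖v 0‖ / v 0 :=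
    ⟨_, Complex.cpow_nat_inv_pow _ hn0⟩
  have hξn : ‖ξ‖ = 1 := by
    have : ‖ξ‖ ^ n = 1 := by
      rw [← norm_pow, hξ, norm_div]
      simp [hv0]
    exact (pow_eq_one_iff_of_nonneg (norm_nonneg _) hn0).1 this
  obtain ⟨C, hC⟩ := (hf (n + 1)).bound
  have hray : Tendsto (fun t : ℝ => (t : ℂ) * ξ) (𝓝[>] 0) (𝓝 0) := by
    have : Continuous fun t : ℝ => (t : ℂ) * ξ := by fun_prop
    have := this.tendsto 0
    simp only [Complex.ofReal_zero, zero_mul] at this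
    exact this.mono_left nhdsWithin_le_nhds
  have h1 : ∀ᶠ t : ℝ in 𝓝[>] 0, (ξ ^ n * v (t * ξ)).re ≤ C * t := by
    filter_upwards [hray.eventually hC, hray.eventually hev, self_mem_nhdsWithin] with t ht1 ht2 ht
    have ht : 0 < t := ht
    have e : (u (t * ξ)).re = t ^ n * (ξ ^ n * v (t * ξ)).re := by
      have := congrArg Complex.re ht2
      simp only [sub_zero, smul_eq_mul, Complex.sub_re, h0] at this
      rw [this, mul_pow, mul_assoc, ← Complex.ofReal_pow, Complex.re_ofReal_mul]
    have hnt : ‖(t : ℂ) * ξ‖ = t := by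
      rw [norm_mul, Complex.norm_real, hξn, mul_one, Real.norm_of_nonneg ht.le]
    rw [e, hnt, norm_mul, norm_pow, norm_pow, Real.norm_of_nonneg ht.le, Real.norm_eq_abs,
      pow_succ] at ht1
    have : t ^ n * (ξ ^ n * v (t * ξ)).re ≤ t ^ n * (C * t) := by
      have := mul_le_mul_of_nonneg_left (le_abs_self (ξ ^ n * v (t * ξ)).re) (pow_nonneg ht.le n)
      linarith
    exact le_of_mul_le_mul_left this (by positivity)
  have h2 : Tendsto (fun t : ℝ => (ξ ^ n * v (t * ξ)).re) (𝓝[>] 0) (𝓝 ‖v 0‖) := by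
    have h3 := (hv.continuousAt.tendsto).comp hray
    have h4 := (Complex.continuous_re.tendsto _).comp (h3.const_mul (ξ ^ n))
    rw [show ξ ^ n * v 0 = ((‖v 0‖ : ℝ) : ℂ) by rw [hξ, div_mul_cancel₀ _ hv0],
      Complex.ofReal_re] at h4
    exact h4
  have h3 : Tendsto (fun t : ℝ => C * t) (𝓝[>] 0) (𝓝 0) := by
    have : Continuous fun t : ℝ => C * t := by fun_prop
    have := this.tendsto 0
    simp only [mul_zero] at this
    exact this.mono_left nhdsWithin_le_nhds
  have := le_of_tendsto_of_tendsto h2 h3 h1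
  exact hv0 (norm_le_zero_iff.1 this)

/-- The properties of `P` used below: `P` is smooth near `0` and vanishes there to infinite order,
together with its derivative, and no nontrivial connected set of zeros passes through `0`. -/
structure FlatModel (P : ℂ → ℝ) (ε : ℝ) : Prop where
  pos : 0 < ε
  smooth : ContDiffOn ℝ ∞ P (Metric.ball 0 ε)
  flat : Flat P
  flat_fderiv : Flat (fderiv ℝ P)
  isolated : ∀ S ⊆ Metric.ball (0 : ℂ) ε, IsPreconnected S → (0 : ℂ) ∈ S → (∀ z ∈ S, P z = 0) →
    S ⊆ {0}

lemma flatModel_of_connectedComponentIn {ε : ℝ} (hε : 0 < ε) {P : ℂ → ℝ}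
    (hP : ContDiffOn ℝ ∞ P (Metric.ball (0 : ℂ) ε))
    (hzero : connectedComponentIn (zeroSet ε P) 0 = {0})
    (hinf : connectedComponentIn (SInf ε P) 0 = {0}) : FlatModel P ε := by
  have hmem : ∀ {F : Set ℂ}, connectedComponentIn F 0 = {0} → (0 : ℂ) ∈ F := by
    intro F hF
    by_contra h
    rw [connectedComponentIn_eq_empty h] at hF
    exact (Set.singleton_ne_empty _ hF.symm)
  have hP0 : P 0 = 0 := (hmem hzero).2
  have hnu : nu P 0 = ⊤ := (hmem hinf).2
  have hder : ∀ n : ℕ, iteratedFDeriv ℝ n P 0 = 0 := by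
    intro n
    by_contra h
    have : nu P 0 ≤ n := by
      refine sInf_le ⟨n, rfl, ?_⟩
      simpa [hP0] using h
    rw [hnu] at this
    simp at this
  have h0 : (0 : ℂ) ∈ Metric.ball (0 : ℂ) ε := by simpa using hε
  refine ⟨hε, hP, fun N => isBigO_pow_of_iteratedFDeriv_eq_zero N Metric.isOpen_ball h0 hP hder,
    fun N => isBigO_pow_of_iteratedFDeriv_eq_zero N Metric.isOpen_ball h0
      (hP.fderiv_of_isOpen Metric.isOpen_ball (m := ∞) (by simp)) fun n => ?_, ?_⟩
  · rw [← norm_eq_zero, norm_iteratedFDeriv_fderiv, hder, norm_zero]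
  · intro S hS hc h0S hz
    rw [← hzero]
    exact hc.subset_connectedComponentIn h0S fun z hzS => ⟨hS hzS, hz z hzS⟩

namespace FlatModel
variable {P : ℂ → ℝ} {ε : ℝ}

lemma hasFDerivAt (M : FlatModel P ε) {z : ℂ} (hz : z ∈ Metric.ball (0 : ℂ) ε) :
    HasFDerivAt P (fderiv ℝ P z) z :=
  ((M.smooth.contDiffAt (Metric.isOpen_ball.mem_nhds hz)).differentiableAt (by simp)).hasFDerivAt

lemma continuousAt (M : FlatModel P ε) {z : ℂ} (hz : z ∈ Metric.ball (0 : ℂ) ε) :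
    ContinuousAt P z := (M.hasFDerivAt hz).continuousAt

lemma ball_mem (M : FlatModel P ε) : Metric.ball (0 : ℂ) ε ∈ 𝓝 (0 : ℂ) :=
  Metric.ball_mem_nhds _ M.pos

lemma apply_zero (M : FlatModel P ε) : P 0 = 0 := M.flat.apply_zero

lemma not_eventually_zero (M : FlatModel P ε) : ¬ ∀ᶠ z in 𝓝 (0 : ℂ), P z = 0 := by
  intro h
  obtain ⟨r, hr, hball⟩ := Metric.eventually_nhds_iff_ball.1 (h.and M.ball_mem)
  have := M.isolated (Metric.ball 0 r) (fun z hz => (hball z hz).2)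
    (convex_ball _ _).isPreconnected (by simpa using hr) (fun z hz => (hball z hz).1)
  have h2 : ((r / 2 : ℝ) : ℂ) ∈ Metric.ball (0 : ℂ) r := by
    simp [abs_of_pos hr]; linarith
  have := this h2
  simp at this
  linarith

/-- The rate of change of `P` along a curve. -/
lemma hasDerivAt_comp (M : FlatModel P ε) {γ : ℝ → ℂ} {v : ℂ} {s : ℝ} (hγ : HasDerivAt γ v s)
    (hz : γ s ∈ Metric.ball (0 : ℂ) ε) : HasDerivAt (fun s => P (γ s)) (fderiv ℝ P (γ s) v) s :=
  (M.hasFDerivAt hz).comp_hasDerivAt s hγ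

end FlatModel

/-! ### Planar holomorphic vector fields and the growth of `P` along them -/

/-- A function whose logarithmic derivative is within `e` of `μ` grows at rate at least `μ - e`; here `E`
is a primitive of `e`. -/
lemma abs_le_mul_exp_of_deriv {p p' e E : ℝ → ℝ} {μ T : ℝ} (hT : 0 ≤ T)
    (hp : ∀ s ∈ Set.Icc 0 T, HasDerivWithinAt p (p' s) (Set.Icc 0 T) s)
    (hE : ∀ s ∈ Set.Icc 0 T, HasDerivAt E (e s) s)
    (h : ∀ s ∈ Set.Icc 0 T, |p' s - μ * p s| ≤ e s * |p s|) :
    |p 0| ≤ |p T| * Real.exp (-μ * T + (E T - E 0)) := by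
  set q : ℝ → ℝ := fun s => p s ^ 2 * Real.exp (-2 * μ * s + 2 * E s) with hq
  have hder : ∀ s ∈ Set.Icc 0 T, HasDerivWithinAt q
      (2 * (p s * (p' s - μ * p s) + e s * p s ^ 2) * Real.exp (-2 * μ * s + 2 * E s))
      (Set.Icc 0 T) s := by
    intro s hs
    have h1 := (hp s hs).pow 2
    have h2 : HasDerivWithinAt (fun s => -2 * μ * s + 2 * E s) (-2 * μ + 2 * e s)
        (Set.Icc 0 T) s := by
      refine HasDerivWithinAt.add ?_ ((hE s hs).const_mul 2).hasDerivWithinAt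
      have h3 := ((hasDerivAt_id s).const_mul (-2 * μ)).hasDerivWithinAt (s := Set.Icc 0 T)
      rwa [mul_one] at h3
    refine (h1.mul h2.exp).congr_deriv ?_
    simp
    ring
  have hmono : MonotoneOn q (Set.Icc 0 T) := by
    refine monotoneOn_of_hasDerivWithinAt_nonneg (convex_Icc 0 T)
      (fun s hs => (hder s hs).continuousWithinAt)
      (fun s hs => (hder s (interior_subset hs)).mono interior_subset) ?_
    intro s hs
    have hs' := interior_subset hs
    have h1 := h s hs'
    have h2 : -(p s * (p' s - μ * p s)) ≤ e s * p s ^ 2 := by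
      calc -(p s * (p' s - μ * p s)) ≤ |p s * (p' s - μ * p s)| := neg_le_abs _
        _ = |p s| * |p' s - μ * p s| := abs_mul _ _
        _ ≤ |p s| * (e s * |p s|) := by gcongr
        _ = e s * p s ^ 2 := by rw [← sq_abs (p s)]; ring
    have : 0 ≤ p s * (p' s - μ * p s) + e s * p s ^ 2 := by linarith
    positivity
  have h0T := hmono (Set.left_mem_Icc.2 hT) (Set.right_mem_Icc.2 hT) hT
  simp only [hq] at h0T
  rw [← abs_of_nonneg (show 0 ≤ |p T| * Real.exp (-μ * T + (E T - E 0)) by positivity),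
    ← abs_abs (p 0), ← sq_le_sq, mul_pow, sq_abs, sq_abs, ← Real.exp_nat_mul]
  have e1 : p 0 ^ 2 = p 0 ^ 2 * Real.exp (-2 * μ * 0 + 2 * E 0) * Real.exp (-2 * E 0) := by
    rw [mul_assoc, ← Real.exp_add]; simp
  rw [e1]
  refine (mul_le_mul_of_nonneg_right h0T (Real.exp_pos _).le).trans (le_of_eq ?_)
  rw [mul_assoc, ← Real.exp_add]
  congr 2
  push_cast
  ring

/-- `P` changes along the vector field `H` at the logarithmic rate `μ`, up to a relative error
vanishing to infinite order at `0`. -/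
def LogTangent (P : ℂ → ℝ) (H : ℂ → ℂ) (μ : ℝ) : Prop :=
  ∀ N : ℕ, ∃ C : ℝ, ∀ᶠ z in 𝓝 (0 : ℂ),
    |fderiv ℝ P z (H z) - μ * P z| ≤ C * ‖z‖ ^ N * |P z|

lemma LogTangent.neg {P : ℂ → ℝ} {H : ℂ → ℂ} {μ : ℝ} (h : LogTangent P H μ) :
    LogTangent P (fun z => -H z) (-μ) := by
  intro N
  obtain ⟨C, hC⟩ := h N
  refine ⟨C, hC.mono fun z hz => ?_⟩
  rw [map_neg, neg_mul, ← neg_sub', abs_neg]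
  exact hz

lemma LogTangent.sub_smul {P : ℂ → ℝ} {H K : ℂ → ℂ} (hH : LogTangent P H 0)
    (hK : LogTangent P K 0) (κ : ℝ) : LogTangent P (fun z => H z - κ * K z) 0 := by
  intro N
  obtain ⟨C, hC⟩ := hH N
  obtain ⟨D, hD⟩ := hK N
  refine ⟨C + |κ| * D, (hC.and hD).mono fun z hz => ?_⟩
  obtain ⟨h1, h2⟩ := hz
  beta_reduce
  rw [← Complex.real_smul, map_sub, map_smul, smul_eq_mul]
  simp only [zero_mul, sub_zero] at h1 h2 ⊢
  calc |fderiv ℝ P z (H z) - κ * fderiv ℝ P z (K z)|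
      ≤ |fderiv ℝ P z (H z)| + |κ * fderiv ℝ P z (K z)| := abs_sub _ _
    _ = |fderiv ℝ P z (H z)| + |κ| * |fderiv ℝ P z (K z)| := by rw [abs_mul]
    _ ≤ C * ‖z‖ ^ N * |P z| + |κ| * (D * ‖z‖ ^ N * |P z|) := by gcongr
    _ = _ := by ring

lemma exists_eq_mul_of_analyticAt {f : ℂ → ℂ} (hf : AnalyticAt ℂ f 0) (h0 : f 0 = 0) :
    ∃ k : ℂ → ℂ, AnalyticAt ℂ k 0 ∧ k 0 = deriv f 0 ∧ ∀ᶠ z in 𝓝 (0 : ℂ), f z = z * k z := by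
  have h1 : ((1 : ℕ) : ℕ∞) ≤ analyticOrderAt f 0 := by
    rw [Nat.cast_one, Order.one_le_iff_ne_zero]
    exact fun h => (hf.analyticOrderAt_eq_zero.1 h) h0
  obtain ⟨k, hk, hev⟩ := (natCast_le_analyticOrderAt hf).1 h1
  have hev' : ∀ᶠ z in 𝓝 (0 : ℂ), f z = z * k z := by simpa using hev
  refine ⟨k, hk, ?_, hev'⟩
  rw [EventuallyEq.deriv_eq hev']
  have : HasDerivAt (fun z => z * k z) (1 * k 0 + 0 * deriv k 0) 0 :=
    (hasDerivAt_id (0 : ℂ)).mul hk.differentiableAt.hasDerivAt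
  rw [this.deriv]
  simp

/-- A holomorphic vector field with a nondegenerate zero is linear in a suitable coordinate: if
`T' / T = H' (0) / H` with `T' (0) = 1`, then the inverse `φ` of `T` linearizes `H`. -/
lemma exists_linearization {H : ℂ → ℂ} (hH : AnalyticAt ℂ H 0) (h0 : H 0 = 0)
    (hd : deriv H 0 ≠ 0) : ∃ φ : ℂ → ℂ, AnalyticAt ℂ φ 0 ∧ φ 0 = 0 ∧ deriv φ 0 = 1 ∧
      ∀ᶠ ζ in 𝓝 (0 : ℂ), H (φ ζ) = deriv H 0 * ζ * deriv φ ζ := by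
  obtain ⟨k, hk, hk0, hHk⟩ := exists_eq_mul_of_analyticAt hH h0
  have hk0' : k 0 ≠ 0 := hk0 ▸ hd
  obtain ⟨g, hg, -, hgq⟩ := exists_eq_mul_of_analyticAt (f := fun z => deriv H 0 / k z - 1)
    ((analyticAt_const.div hk hk0').sub analyticAt_const) (by simp [hk0, hd])
  obtain ⟨r, hr, hball⟩ := Metric.eventually_nhds_iff_ball.1
    ((hg.eventually_analyticAt.and hHk).and (hgq.and (hk.continuousAt.eventually_ne hk0')))
  obtain ⟨G, hG0, hG⟩ := (DifferentiableOn.isExactOn_ball (f := g) (c := 0) (r := r)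
    fun z hz => ((hball z hz).1.1.differentiableAt).differentiableWithinAt).with_val_at 0 0
  set T : ℂ → ℂ := fun z => z * Complex.exp (G z) with hTdef
  have hTd : ∀ z ∈ Metric.ball (0 : ℂ) r,
      HasDerivAt T (Complex.exp (G z) * (1 + z * g z)) z := by
    intro z hz
    refine ((hasDerivAt_id z).mul (hG z hz).cexp).congr_deriv ?_
    simp only [id]
    ring
  have hHT : ∀ z ∈ Metric.ball (0 : ℂ) r, H z * deriv T z = deriv H 0 * T z := by
    intro z hz
    obtain ⟨⟨-, h1⟩, h2, h3⟩ := hball z hz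
    rw [(hTd z hz).deriv, h1, ← h2, hTdef]
    field_simp
    ring
  have h0b : (0 : ℂ) ∈ Metric.ball (0 : ℂ) r := by simpa using hr
  have hTan : AnalyticAt ℂ T 0 := DifferentiableOn.analyticAt (s := Metric.ball 0 r)
    (fun z hz => (hTd z hz).differentiableAt.differentiableWithinAt) (Metric.ball_mem_nhds _ hr)
  have hT1 : deriv T 0 = 1 := by rw [(hTd 0 h0b).deriv]; simp [hG0]
  have hT0 : T 0 = 0 := by simp [hTdef]
  have hT1' : deriv T 0 ≠ 0 := by rw [hT1]; exact one_ne_zero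
  set φ := hTan.hasStrictDerivAt.localInverse _ _ _ hT1' with hφdef
  have hφan : AnalyticAt ℂ φ 0 := by
    have := hTan.analyticAt_localInverse hT1'
    rwa [hT0] at this
  have hφ0 : φ 0 = 0 := by
    have : φ (T 0) = 0 := HasStrictFDerivAt.localInverse_apply_image ..
    rwa [hT0] at this
  have hinv : ∀ᶠ ζ in 𝓝 (0 : ℂ), T (φ ζ) = ζ := by
    have := hTan.hasStrictDerivAt.eventually_right_inverse hT1'
    rwa [hT0] at this
  have hφmem : ∀ᶠ ζ in 𝓝 (0 : ℂ), φ ζ ∈ Metric.ball (0 : ℂ) r := by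
    refine hφan.continuousAt.eventually_mem ?_
    rw [hφ0]
    exact Metric.ball_mem_nhds _ hr
  have hchain : ∀ᶠ ζ in 𝓝 (0 : ℂ), deriv T (φ ζ) * deriv φ ζ = 1 := by
    filter_upwards [hinv.eventually_nhds, hφmem, hφan.eventually_analyticAt] with ζ h1 h2 h3
    have h4 := ((hTd _ h2).differentiableAt.hasDerivAt).comp ζ h3.differentiableAt.hasDerivAt
    have h5 : HasDerivAt (T ∘ φ) 1 ζ := (hasDerivAt_id ζ).congr_of_eventuallyEq h1
    exact h4.unique h5
  refine ⟨φ, hφan, hφ0, ?_, ?_⟩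
  · have := hchain.self_of_nhds
    rwa [hφ0, hT1, one_mul] at this
  · filter_upwards [hinv, hφmem, hchain] with ζ h1 h2 h3
    have := hHT _ h2
    rw [h1] at this
    rw [← this, mul_assoc, h3, mul_one]

lemma eventually_of_eventually_comp {φ : ℂ → ℂ} (hφ : AnalyticAt ℂ φ 0) (h0 : φ 0 = 0)
    (hd : deriv φ 0 ≠ 0) {p : ℂ → Prop} (h : ∀ᶠ ζ in 𝓝 (0 : ℂ), p (φ ζ)) :
    ∀ᶠ z in 𝓝 (0 : ℂ), p z := by
  have := hφ.hasStrictDerivAt.map_nhds_eq hd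
  rw [h0] at this
  rw [← this]
  exact h

lemma tendsto_zero_of_analyticAt {φ : ℂ → ℂ} (hφ : AnalyticAt ℂ φ 0) (h0 : φ 0 = 0) :
    Tendsto φ (𝓝 0) (𝓝 0) := by
  have := hφ.continuousAt.tendsto
  rwa [h0] at this

lemma isBigO_id_of_analyticAt {φ : ℂ → ℂ} (hφ : AnalyticAt ℂ φ 0) (h0 : φ 0 = 0) :
    φ =O[𝓝 0] fun z : ℂ => z := by
  simpa [h0] using hφ.differentiableAt.isBigO_sub

/-- In a linearizing coordinate, the integral curves are exponentials. -/
lemma hasDerivAt_linearized {H φ : ℂ → ℂ} {l ζ : ℂ} {s : ℝ}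
    (hφ : DifferentiableAt ℂ φ (ζ * Complex.exp (l * s)))
    (hH : H (φ (ζ * Complex.exp (l * s))) =
      l * (ζ * Complex.exp (l * s)) * deriv φ (ζ * Complex.exp (l * s))) :
    HasDerivAt (fun s : ℝ => φ (ζ * Complex.exp (l * s))) (H (φ (ζ * Complex.exp (l * s)))) s := by
  have h1 : HasDerivAt (fun s : ℝ => ζ * Complex.exp (l * s)) (l * (ζ * Complex.exp (l * s))) s := by
    have h2 : HasDerivAt (fun s : ℝ => l * (s : ℂ)) l s := by
      simpa using (Complex.ofRealCLM.hasDerivAt (x := s)).const_mul l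
    refine (h2.cexp.const_mul ζ).congr_deriv ?_
    ring
  rw [hH, mul_comm]
  exact hφ.hasDerivAt.comp s h1

lemma norm_mul_exp (ζ l : ℂ) (s : ℝ) :
    ‖ζ * Complex.exp (l * s)‖ = ‖ζ‖ * Real.exp (l.re * s) := by
  rw [norm_mul, Complex.norm_exp]
  simp

namespace FlatModel
variable {P : ℂ → ℝ} {ε : ℝ} {H : ℂ → ℂ} {μ : ℝ}

/-- At an attracting zero of `H` the function `P` would decay at most exponentially along the integral
curves, which is impossible for a flat function. -/
lemma re_deriv_not_neg (M : FlatModel P ε) (hH : AnalyticAt ℂ H 0) (h0 : H 0 = 0)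
    (hP : LogTangent P H μ) : ¬ (deriv H 0).re < 0 := by
  intro hneg
  have hl : deriv H 0 ≠ 0 := by
    intro h; rw [h] at hneg; simp at hneg
  obtain ⟨φ, hφ, hφ0, hφ1, hlin⟩ := exists_linearization hH h0 hl
  have hφ1' : deriv φ 0 ≠ 0 := by rw [hφ1]; exact one_ne_zero
  set l := deriv H 0 with hldef
  obtain ⟨C, hC⟩ := hP 0
  obtain ⟨N, hN⟩ := exists_nat_ge ((C - μ + 1) / (-l.re))
  rw [div_le_iff₀ (by linarith)] at hN
  have hφt := tendsto_zero_of_analyticAt hφ hφ0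
  obtain ⟨D, hD⟩ := ((M.flat.comp_isBigO hφt (isBigO_id_of_analyticAt hφ hφ0)) N).bound
  obtain ⟨r, hr, hball⟩ := Metric.eventually_nhds_iff_ball.1
    (((hφt.eventually hC).and (hφt.eventually M.ball_mem)).and
      (hD.and (hlin.and hφ.eventually_analyticAt)))
  refine M.not_eventually_zero (eventually_of_eventually_comp hφ hφ0 hφ1' ?_)
  filter_upwards [Metric.ball_mem_nhds _ hr] with ζ hζ
  have hmem : ∀ s : ℝ, 0 ≤ s → ζ * Complex.exp (l * s) ∈ Metric.ball (0 : ℂ) r := by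
    intro s hs
    rw [mem_ball_zero_iff, norm_mul_exp]
    refine lt_of_le_of_lt (mul_le_of_le_one_right (norm_nonneg _) ?_) (mem_ball_zero_iff.1 hζ)
    rw [Real.exp_le_one_iff]
    exact mul_nonpos_of_nonpos_of_nonneg hneg.le hs
  have key : ∀ T : ℝ, 0 ≤ T → |P (φ ζ)| ≤ D * ‖ζ‖ ^ N * Real.exp (-T) := by
    intro T hT
    have h1 := abs_le_mul_exp_of_deriv (p := fun s : ℝ => P (φ (ζ * Complex.exp (l * s))))
      (p' := fun s : ℝ => fderiv ℝ P (φ (ζ * Complex.exp (l * s)))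
        (H (φ (ζ * Complex.exp (l * s))))) (e := fun _ => C) (E := fun s => C * s) (μ := μ) hT
      (fun s hs => ?_) (fun s _ => ?_) (fun s hs => ?_)
    · simp only [Complex.ofReal_zero, mul_zero, Complex.exp_zero, mul_one, sub_zero] at h1
      have h2 := (hball _ (hmem T hT)).2.1
      rw [Real.norm_eq_abs, norm_pow, norm_norm, norm_mul_exp, mul_pow, ← Real.exp_nat_mul] at h2
      have hD0 : 0 ≤ D * ‖ζ‖ ^ N := by
        have := (hball ζ hζ).2.1
        rw [norm_pow, norm_norm] at this
        exact (norm_nonneg _).trans this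
      calc |P (φ ζ)| ≤ _ := h1
        _ ≤ D * (‖ζ‖ ^ N * Real.exp (N * (l.re * T))) * Real.exp (-μ * T + C * T) := by gcongr
        _ = D * ‖ζ‖ ^ N * Real.exp (N * (l.re * T) + (-μ * T + C * T)) := by
          rw [Real.exp_add (N * (l.re * T))]; ring
        _ ≤ D * ‖ζ‖ ^ N * Real.exp (-T) := by
          gcongr
          nlinarith
    · have hb := hball _ (hmem s hs.1)
      exact (M.hasDerivAt_comp (hasDerivAt_linearized hb.2.2.2.differentiableAt hb.2.2.1)
        hb.1.2).hasDerivWithinAt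
    · simpa using (hasDerivAt_id s).const_mul C
    · simpa using (hball _ (hmem s hs.1)).1.1
  have hlim : Tendsto (fun T : ℝ => D * ‖ζ‖ ^ N * Real.exp (-T)) atTop (𝓝 0) := by
    simpa using (Real.tendsto_exp_neg_atTop_nhds_zero).const_mul (D * ‖ζ‖ ^ N)
  have := ge_of_tendsto hlim (eventually_atTop.2 ⟨0, key⟩)
  exact abs_nonpos_iff.1 this

/-- Around a centre of `H` the integral curves are closed, so `P` cannot grow along them. -/
lemma rate_not_pos_of_center (M : FlatModel P ε) (hH : AnalyticAt ℂ H 0) (h0 : H 0 = 0)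
    (hl : deriv H 0 ≠ 0) (hre : (deriv H 0).re = 0) (hP : LogTangent P H μ) : ¬ 0 < μ := by
  intro hμ
  obtain ⟨φ, hφ, hφ0, hφ1, hlin⟩ := exists_linearization hH h0 hl
  have hφ1' : deriv φ 0 ≠ 0 := by rw [hφ1]; exact one_ne_zero
  set l := deriv H 0 with hldef
  obtain ⟨C, hC⟩ := hP 1
  have hφt := tendsto_zero_of_analyticAt hφ hφ0
  have hsmall : ∀ᶠ z in 𝓝 (0 : ℂ), C * ‖z‖ ^ 1 < μ / 2 := by
    have : ContinuousAt (fun z : ℂ => C * ‖z‖ ^ 1) 0 := by fun_prop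
    refine this.eventually_lt continuousAt_const ?_
    simpa using hμ
  obtain ⟨r, hr, hball⟩ := Metric.eventually_nhds_iff_ball.1
    (((hφt.eventually hC).and (hφt.eventually M.ball_mem)).and
      ((hφt.eventually hsmall).and (hlin.and hφ.eventually_analyticAt)))
  refine M.not_eventually_zero (eventually_of_eventually_comp hφ hφ0 hφ1' ?_)
  filter_upwards [Metric.ball_mem_nhds _ hr] with ζ hζ
  have hmem : ∀ s : ℝ, ζ * Complex.exp (l * s) ∈ Metric.ball (0 : ℂ) r := by
    intro s
    rw [mem_ball_zero_iff, norm_mul_exp, hre]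
    simpa using hζ
  have him : l.im ≠ 0 := fun h => hl (Complex.ext (by simpa using hre) (by simpa using h))
  -- the period of the integral curves
  set T : ℝ := 2 * Real.pi / |l.im| with hTdef
  have hT : 0 < T := by positivity
  have hper : Complex.exp (l * T) = 1 := by
    rw [Complex.exp_eq_one_iff]
    have hl' : l = l.im * Complex.I := by
      apply Complex.ext <;> simp [hre]
    rcases lt_or_gt_of_ne him with h | h
    · refine ⟨-1, ?_⟩
      rw [hl', hTdef, abs_of_neg h]
      have : (l.im : ℂ) ≠ 0 := by exact_mod_cast him
      push_cast
      simp
      field_simp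
    · refine ⟨1, ?_⟩
      rw [hl', hTdef, abs_of_pos h]
      have : (l.im : ℂ) ≠ 0 := by exact_mod_cast him
      push_cast
      simp
      field_simp
  have h1 := abs_le_mul_exp_of_deriv (p := fun s : ℝ => P (φ (ζ * Complex.exp (l * s))))
      (p' := fun s : ℝ => fderiv ℝ P (φ (ζ * Complex.exp (l * s)))
        (H (φ (ζ * Complex.exp (l * s))))) (e := fun _ => μ / 2) (E := fun s => μ / 2 * s) (μ := μ)
      hT.le (fun s hs => ?_) (fun s _ => ?_) (fun s hs => ?_)
  · simp only [Complex.ofReal_zero, mul_zero, Complex.exp_zero, mul_one, sub_zero, hper] at h1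
    have h2 : Real.exp (-μ * T + μ / 2 * T) < 1 := by
      rw [Real.exp_lt_one_iff]
      nlinarith
    by_contra hne
    have h3 : 0 < |P (φ ζ)| := abs_pos.2 hne
    nlinarith
  · have hb := hball _ (hmem s)
    exact (M.hasDerivAt_comp (hasDerivAt_linearized hb.2.2.2.differentiableAt hb.2.2.1)
      hb.1.2).hasDerivWithinAt
  · simpa using (hasDerivAt_id s).const_mul (μ / 2)
  · have hb := hball _ (hmem s)
    exact hb.1.1.trans (mul_le_mul_of_nonneg_right hb.2.1.le (abs_nonneg _))

/-- If `H 0 ≠ 0`, then `P` vanishes along the integral curve of `H` through `0`. -/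
lemma vectorField_apply_zero (M : FlatModel P ε) (hH : AnalyticAt ℂ H 0)
    (hP : LogTangent P H μ) : H 0 = 0 := by
  by_contra hne
  have hcd : ContDiffAt ℝ 1 H 0 := (hH.contDiffAt (n := 1)).restrict_scalars ℝ
  obtain ⟨γ, hγ0, δ, hδ, hγ⟩ :=
    hcd.exists_forall_mem_closedBall_exists_eq_forall_mem_Ioo_hasDerivAt₀ 0
  simp only [zero_sub, zero_add] at hγ
  obtain ⟨C, hC⟩ := hP 0
  have hγc : ContinuousAt γ 0 := (hγ 0 ⟨by linarith, hδ⟩).continuousAt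
  have hgood : ∀ᶠ s in 𝓝 (0 : ℝ), γ s ∈ Metric.ball (0 : ℂ) ε ∧
      |fderiv ℝ P (γ s) (H (γ s)) - μ * P (γ s)| ≤ C * ‖γ s‖ ^ 0 * |P (γ s)| := by
    have : Tendsto γ (𝓝 0) (𝓝 0) := by simpa [hγ0] using hγc.tendsto
    exact (this.eventually M.ball_mem).and (this.eventually hC)
  obtain ⟨η, hη, hgood⟩ := Metric.eventually_nhds_iff_ball.1 hgood
  set T := min δ η / 2 with hT
  have hTpos : 0 < T := by positivity
  have hTδ : T < δ := by have := min_le_left δ η; linarith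
  have hTη : T < η := by have := min_le_right δ η; linarith
  have hd : ∀ s ∈ Set.Icc 0 T, HasDerivAt γ (H (γ s)) s :=
    fun s hs => hγ s ⟨by linarith [hs.1], by linarith [hs.2]⟩
  have hg : ∀ s ∈ Set.Icc 0 T, _ := fun s hs => hgood s (by
    rw [Metric.mem_ball, Real.dist_eq, sub_zero, abs_of_nonneg hs.1]; linarith [hs.2])
  have hdp := fun s (hs : s ∈ Set.Icc 0 T) => M.hasDerivAt_comp (hd s hs) (hg s hs).1
  have hz : ∀ s ∈ Set.Icc 0 T, P (γ s) = 0 := by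
    refine eq_zero_of_abs_deriv_le_mul_abs_self_of_eq_zero_right (K := |μ| + C)
      (fun s hs => (hdp s hs).continuousAt.continuousWithinAt)
      (fun s hs => (hdp s (Set.Ico_subset_Icc_self hs)).hasDerivWithinAt)
      (by rw [hγ0, M.apply_zero]) (fun s hs => ?_)
    have h1 := (hg s (Set.Ico_subset_Icc_self hs)).2
    rw [pow_zero, mul_one] at h1
    rw [Real.norm_eq_abs, Real.norm_eq_abs]
    have h2 := abs_sub_abs_le_abs_sub (fderiv ℝ P (γ s) (H (γ s))) (μ * P (γ s))
    rw [abs_mul] at h2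
    linarith
  have hS := M.isolated (γ '' Set.Icc 0 T) (by rintro _ ⟨s, hs, rfl⟩; exact (hg s hs).1)
    (isPreconnected_Icc.image _ fun s hs => (hd s hs).continuousAt.continuousWithinAt)
    ⟨0, ⟨le_rfl, hTpos.le⟩, hγ0⟩ (by rintro _ ⟨s, hs, rfl⟩; exact hz s hs)
  have h1 : HasDerivWithinAt γ 0 (Set.Icc 0 T) 0 :=
    (hasDerivWithinAt_const (0 : ℝ) (Set.Icc 0 T) (0 : ℂ)).congr
      (fun s hs => hS ⟨s, hs, rfl⟩) hγ0
  have h2 := (hd 0 ⟨le_rfl, hTpos.le⟩).hasDerivWithinAt (s := Set.Icc 0 T)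
  rw [hγ0] at h2
  exact hne (((uniqueDiffOn_Icc hTpos) 0 ⟨le_rfl, hTpos.le⟩).eq_deriv _ h2 h1)

end FlatModel

/-! ### Degenerate zeros of planar vector fields -/

/-- A branch of `(C u) ^ (-1 / m)` on the right half plane, where `C = exp l`: the coordinate in which
a vector field with a zero of order `m + 1` is close to a constant one. -/
noncomputable def petal (m : ℕ) (l : ℂ) (u : ℂ) : ℂ := Complex.exp (-(Complex.log u + l) / m)

lemma petal_ne_zero (m : ℕ) (l u : ℂ) : petal m l u ≠ 0 := Complex.exp_ne_zero _

lemma petal_pow {m : ℕ} (hm : m ≠ 0) (l : ℂ) {u : ℂ} (hu : u ≠ 0) :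
    petal m l u ^ m = (u * Complex.exp l)⁻¹ := by
  have hm' : (m : ℂ) ≠ 0 := by exact_mod_cast hm
  rw [petal, ← Complex.exp_nat_mul, mul_div_cancel₀ _ hm', Complex.exp_neg, Complex.exp_add,
    Complex.exp_log hu]

lemma hasDerivAt_petal {m : ℕ} {l u : ℂ} (hu : 0 < u.re) :
    HasDerivAt (petal m l) (-petal m l u / (m * u)) u := by
  have h1 := (Complex.hasDerivAt_log (Or.inl hu : u ∈ Complex.slitPlane))
  refine (((h1.add_const l).neg.div_const (m : ℂ)).cexp).congr_deriv ?_
  rw [petal]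
  simp only [Pi.neg_apply]
  simp only [div_eq_mul_inv, mul_inv]
  ring

lemma exists_norm_petal_lt {m : ℕ} (hm : m ≠ 0) (l : ℂ) {ρ : ℝ} (hρ : 0 < ρ) :
    ∃ R : ℝ, 0 < R ∧ ∀ u : ℂ, R ≤ ‖u‖ → ‖petal m l u‖ < ρ := by
  have hE : 0 < ‖Complex.exp l‖ := norm_pos_iff.2 (Complex.exp_ne_zero l)
  refine ⟨2 / (ρ ^ m * ‖Complex.exp l‖), by positivity, fun u hu => ?_⟩
  have hu0 : 0 < ‖u‖ := lt_of_lt_of_le (by positivity) hu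
  refine lt_of_pow_lt_pow_left₀ m hρ.le ?_
  rw [← norm_pow, petal_pow hm l (norm_pos_iff.1 hu0), norm_inv, norm_mul,
    inv_lt_comm₀ (by positivity) (by positivity)]
  rw [div_le_iff₀ (by positivity)] at hu
  rw [inv_eq_one_div, div_lt_iff₀ (by positivity)]
  nlinarith

/-- The nearest point to `u` in the half plane `R ≤ Re`. -/
def halfPlaneProj (R : ℝ) (u : ℂ) : ℂ := ⟨max u.re R, u.im⟩

lemma lipschitzWith_halfPlaneProj (R : ℝ) : LipschitzWith 1 (halfPlaneProj R) := by
  refine LipschitzWith.of_dist_le_mul fun u w => ?_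
  rw [NNReal.coe_one, one_mul, Complex.dist_eq_re_im, Complex.dist_eq_re_im]
  refine Real.sqrt_le_sqrt ?_
  have h : |max u.re R - max w.re R| ≤ |u.re - w.re| := abs_max_sub_max_le_abs _ _ _
  simp only [halfPlaneProj]
  have := sq_le_sq.2 h
  linarith

/-- A bounded Lipschitz field on a half plane whose real part is bounded below has integral curves
for all positive times. -/
lemma exists_integralCurve_halfPlane {f : ℂ → ℂ} {R : ℝ} {K : NNReal}
    (hK : LipschitzOnWith K f {u | R ≤ u.re}) (hf : ∀ u : ℂ, R ≤ u.re → ‖f u - 1‖ ≤ 1 / 2)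
    {u₀ : ℂ} (hu₀ : R ≤ u₀.re) {T : ℝ} (hT : 0 ≤ T) :
    ∃ α : ℝ → ℂ, α 0 = u₀ ∧ ∀ s ∈ Set.Icc 0 T, u₀.re + s / 2 ≤ (α s).re ∧
      HasDerivWithinAt α (f (α s)) (Set.Icc 0 T) s := by
  have hpm : ∀ u, R ≤ (halfPlaneProj R u).re := fun u => le_max_right _ _
  set F : ℂ → ℂ := fun u => f (halfPlaneProj R u) with hF
  have hFK : LipschitzWith K F := by
    have := hK.comp (lipschitzWith_halfPlaneProj R).lipschitzOnWith (s := Set.univ)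
      (fun u _ => hpm u)
    rw [mul_one] at this
    exact lipschitzOnWith_univ.1 this
  have hFn : ∀ u, ‖F u‖ ≤ 2 := fun u => by
    have h1 := hf _ (hpm u)
    have h2 := norm_sub_norm_le (F u) 1
    rw [norm_one] at h2
    change ‖F u - 1‖ ≤ _ at h1
    linarith
  have hFre : ∀ u, 1 / 2 ≤ (F u).re := fun u => by
    have h1 := (Complex.abs_re_le_norm _).trans (hf _ (hpm u))
    rw [Complex.sub_re, Complex.one_re] at h1
    have := (abs_le.1 h1).1
    change -(1 / 2) ≤ (F u).re - 1 at this
    linarith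
  have hpl : IsPicardLindelof (fun _ => F) (tmin := 0) (tmax := T) ⟨0, le_rfl, hT⟩ u₀
      (2 * NNReal.mk T hT) 0 2 K :=
    IsPicardLindelof.of_time_independent (fun u _ => hFn u) hFK.lipschitzOnWith (by simp [hT])
  obtain ⟨α, hα0, hα⟩ := hpl.exists_eq_forall_mem_Icc_hasDerivWithinAt₀
  have hre : ∀ s ∈ Set.Icc 0 T, u₀.re + s / 2 ≤ (α s).re := by
    have hd : ∀ s ∈ Set.Icc 0 T, HasDerivWithinAt (fun s => (α s).re - s / 2)
        ((F (α s)).re - 1 / 2) (Set.Icc 0 T) s := fun s hs =>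
      (Complex.reCLM.hasFDerivAt.comp_hasDerivWithinAt s (hα s hs)).sub
        ((hasDerivAt_id s).div_const 2).hasDerivWithinAt
    have hmono : MonotoneOn (fun s => (α s).re - s / 2) (Set.Icc 0 T) :=
      monotoneOn_of_hasDerivWithinAt_nonneg (convex_Icc 0 T)
        (fun s hs => (hd s hs).continuousWithinAt)
        (fun s hs => (hd s (interior_subset hs)).mono interior_subset)
        (fun s _ => by have := hFre (α s); linarith)
    intro s hs
    have := hmono (Set.left_mem_Icc.2 hT) hs hs.1
    simp only [hα0, zero_div, sub_zero] at this
    linarith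
  refine ⟨α, hα0, fun s hs => ⟨hre s hs, ?_⟩⟩
  have hproj : halfPlaneProj R (α s) = α s := by
    apply Complex.ext
    · exact max_eq_left (by have := hre s hs; have := hs.1; linarith)
    · rfl
  have := hα s hs
  simp only [hF, hproj] at this
  exact this

namespace FlatModel
variable {P : ℂ → ℝ} {ε : ℝ} {H : ℂ → ℂ} {μ : ℝ}

/-- If `H` had a zero of order `m + 1`, the integral curves in a petal would tend to `0`, with
`‖z‖ ^ m` comparable to the inverse of the time, so that the errors of order `‖z‖ ^ (2 * m)` are
integrable. As `μ ≥ 0`, the function `P` could then not decrease to `0` along them and would vanish on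
the petal, which is connected and has `0` in its closure. -/
lemma not_degenerate (M : FlatModel P ε) {v : ℂ → ℂ} (hv : AnalyticAt ℂ v 0) (hv0 : v 0 ≠ 0)
    {m : ℕ} (hm : m ≠ 0) (hH : ∀ᶠ z in 𝓝 (0 : ℂ), H z = z ^ (m + 1) * v z)
    (hP : LogTangent P H μ) : ¬ 0 ≤ μ := by
  intro hμ
  have hm' : (m : ℂ) ≠ 0 := by exact_mod_cast hm
  set a := v 0 with ha
  -- the normalization for which the field becomes close to `1` in the coordinate `u`
  set l := Complex.log (-(m * a)) with hl
  have hexp : Complex.exp l = -(m * a) := Complex.exp_log (neg_ne_zero.2 (mul_ne_zero hm' hv0))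
  obtain ⟨D₀, hD₀⟩ := hP (2 * m)
  set D := max D₀ 0 with hDdef
  have hD0 : 0 ≤ D := le_max_right _ _
  have hD : ∀ᶠ z in 𝓝 (0 : ℂ), |fderiv ℝ P z (H z) - μ * P z| ≤ D * ‖z‖ ^ (2 * m) * |P z| := by
    filter_upwards [hD₀] with z hz
    refine hz.trans ?_
    gcongr
    exact le_max_left _ _
  have hsmall : ∀ᶠ z in 𝓝 (0 : ℂ), ‖v z / a - 1‖ ≤ 1 / 2 := by
    have h1 : ContinuousAt (fun z => ‖v z / a - 1‖) 0 :=
      ((hv.continuousAt.div_const a).sub continuousAt_const).norm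
    have h2 : ‖v 0 / a - 1‖ < 1 / 2 := by rw [← ha, div_self hv0]; simp
    exact (h1.eventually_lt continuousAt_const h2).mono fun z hz => hz.le
  have hbd : ∀ᶠ z in 𝓝 (0 : ℂ), ‖deriv v z‖ ≤ ‖deriv v 0‖ + 1 :=
    (hv.deriv.continuousAt.norm.eventually_lt continuousAt_const (by linarith)).mono
      fun z hz => hz.le
  obtain ⟨ρ, hρ, hball⟩ := Metric.eventually_nhds_iff_ball.1
    ((hH.and (hD.and M.ball_mem)).and (hsmall.and (hbd.and hv.eventually_analyticAt)))
  obtain ⟨R₀, hR₀, hR₀'⟩ := exists_norm_petal_lt hm l (lt_min hρ one_pos)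
  set R := max R₀ 1 with hRdef
  have hR1 : 1 ≤ R := le_max_right _ _
  have hnorm : ∀ u : ℂ, R ≤ u.re → R ≤ ‖u‖ := fun u hu => hu.trans (Complex.re_le_norm u)
  have hpetal : ∀ u : ℂ, R ≤ u.re → ‖petal m l u‖ < min ρ 1 := fun u hu =>
    hR₀' u ((le_max_left _ _).trans (hnorm u hu))
  have hmem : ∀ u : ℂ, R ≤ u.re → petal m l u ∈ Metric.ball (0 : ℂ) ρ := fun u hu =>
    mem_ball_zero_iff.2 ((hpetal u hu).trans_le (min_le_left _ _))
  have hne : ∀ u : ℂ, R ≤ u.re → u ≠ 0 := fun u hu h => by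
    rw [h, Complex.zero_re] at hu; linarith
  set f : ℂ → ℂ := fun u => v (petal m l u) / a with hf
  have hfd : ∀ u : ℂ, R ≤ u.re → HasDerivAt f
      (deriv v (petal m l u) * (-petal m l u / (m * u)) / a) u := fun u hu =>
    (((hball _ (hmem u hu)).2.2.2.differentiableAt.hasDerivAt).comp u
      (hasDerivAt_petal (by linarith))).div_const a
  set K : NNReal := NNReal.mk ((‖deriv v 0‖ + 1) / ‖a‖) (by positivity) with hK
  have hLip : LipschitzOnWith K f {u | R ≤ u.re} := by
    refine (convex_halfSpace_re_ge R).lipschitzOnWith_of_nnnorm_hasDerivWithin_le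
      (fun u hu => (hfd u hu).hasDerivWithinAt) fun u hu => ?_
    rw [← NNReal.coe_le_coe, coe_nnnorm, hK, NNReal.coe_mk, norm_div, norm_mul, norm_div, norm_neg,
      norm_mul]
    have hm1 : (1 : ℝ) ≤ ‖(m : ℂ)‖ := by
      rw [Complex.norm_natCast]; exact_mod_cast Nat.one_le_iff_ne_zero.2 hm
    have hu1 : 1 ≤ ‖u‖ := hR1.trans (hnorm u hu)
    have h1 : ‖petal m l u‖ / (‖(m : ℂ)‖ * ‖u‖) ≤ 1 := by
      rw [div_le_one (by positivity)]
      exact ((hpetal u hu).le.trans (min_le_right _ _)).trans (one_le_mul_of_one_le_of_one_le hm1 hu1)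
    gcongr
    calc _ ≤ (‖deriv v 0‖ + 1) * 1 := by
          gcongr
          exact (hball _ (hmem u hu)).2.2.1
      _ = _ := mul_one _
  have hf1 : ∀ u : ℂ, R ≤ u.re → ‖f u - 1‖ ≤ 1 / 2 := fun u hu => (hball _ (hmem u hu)).2.1
  set D' := D / ‖Complex.exp l‖ ^ 2 with hD'
  have hD'0 : 0 ≤ D' := by positivity
  -- the growth estimate along the integral curve through `petal m l u₀`
  have key : ∀ u₀ : ℂ, R ≤ u₀.re → ∀ T : ℝ, 0 ≤ T → ∃ u : ℂ, T / 2 ≤ ‖u‖ ∧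
      |P (petal m l u₀)| ≤ |P (petal m l u)| * Real.exp (2 * D') := by
    intro u₀ hu₀ T hT
    obtain ⟨α, hα0, hα⟩ := exists_integralCurve_halfPlane hLip hf1 hu₀ hT
    have hαR : ∀ s ∈ Set.Icc 0 T, R + s / 2 ≤ (α s).re := fun s hs => by
      have := (hα s hs).1; linarith
    have hαR' : ∀ s ∈ Set.Icc 0 T, R ≤ (α s).re := fun s hs => by
      have := hαR s hs; have := hs.1; linarith
    have hder : ∀ s ∈ Set.Icc 0 T, HasDerivWithinAt (fun s => petal m l (α s))
        (H (petal m l (α s))) (Set.Icc 0 T) s := by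
      intro s hs
      have hr := hαR' s hs
      refine ((hasDerivAt_petal (m := m) (l := l) (u := α s) (by linarith)).comp_hasDerivWithinAt s
        (hα s hs).2).congr_deriv ?_
      rw [(hball _ (hmem _ hr)).1.1, pow_succ, petal_pow hm l (hne _ hr), hexp, hf]
      have := hne _ hr
      field_simp
    have h1 := abs_le_mul_exp_of_deriv (p := fun s : ℝ => P (petal m l (α s)))
      (p' := fun s : ℝ => fderiv ℝ P (petal m l (α s)) (H (petal m l (α s))))
      (e := fun s => D' / (R + s / 2) ^ 2) (E := fun s => -2 * D' / (R + s / 2)) (μ := μ)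
      hT (fun s hs => ?_) (fun s hs => ?_) (fun s hs => ?_)
    · refine ⟨α T, ?_, ?_⟩
      · have h2 := hαR T ⟨hT, le_rfl⟩
        have h3 := Complex.re_le_norm (α T)
        linarith
      · simp only [hα0] at h1
        refine h1.trans ?_
        gcongr
        have h2 : -2 * D' / (R + T / 2) ≤ 0 :=
          div_nonpos_of_nonpos_of_nonneg (by linarith) (by positivity)
        have h3 : -2 * D' / (R + 0 / 2) = -(2 * D' / R) := by ring
        have h4 : 2 * D' / R ≤ 2 * D' := div_le_self (by positivity) hR1
        have h5 : 0 ≤ μ * T := by positivity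
        rw [h3]
        linarith
    · exact (M.hasFDerivAt (hball _ (hmem _ (hαR' s hs))).1.2.2).comp_hasDerivWithinAt s (hder s hs)
    · have hs0 := hs.1
      have h2 : HasDerivAt (fun s : ℝ => R + s / 2) (1 / 2) s :=
        ((hasDerivAt_id s).div_const 2).const_add R
      have h3 : R + s / 2 ≠ 0 := by positivity
      refine ((hasDerivAt_const s (-2 * D')).div h2 h3).congr_deriv ?_
      field_simp
      ring
    · have hr := hαR' s hs
      have hs0 := hs.1
      refine (hball _ (hmem _ hr)).1.2.1.trans ?_
      gcongr
      rw [← norm_pow, pow_mul', petal_pow hm l (hne _ hr), hD', norm_pow, norm_inv, norm_mul,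
        inv_pow, ← div_eq_mul_inv, mul_pow, div_div, mul_comm (‖Complex.exp l‖ ^ 2)]
      have hE : 0 < ‖Complex.exp l‖ := norm_pos_iff.2 (Complex.exp_ne_zero l)
      have h2 : R + s / 2 ≤ ‖α s‖ := (hαR s hs).trans (Complex.re_le_norm _)
      gcongr
  have hzero : ∀ u₀ : ℂ, R ≤ u₀.re → P (petal m l u₀) = 0 := by
    intro u₀ hu₀
    refine abs_nonpos_iff.1 (le_of_forall_pos_le_add fun δ hδ => ?_)
    have hc : ∀ᶠ z in 𝓝 (0 : ℂ), |P z| * Real.exp (2 * D') < δ := by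
      have h1 := (M.flat.tendsto.abs).mul_const (Real.exp (2 * D'))
      rw [abs_zero, zero_mul] at h1
      exact h1.eventually_lt_const hδ
    obtain ⟨η, hη, hη'⟩ := Metric.eventually_nhds_iff_ball.1 hc
    obtain ⟨R', hR', hR''⟩ := exists_norm_petal_lt hm l hη
    obtain ⟨u, hu, hu'⟩ := key u₀ hu₀ (2 * R') (by positivity)
    have := hη' _ (mem_ball_zero_iff.2 (hR'' u (by linarith)))
    linarith
  have hpre : IsPreconnected (petal m l '' {u | R ≤ u.re}) :=
    (convex_halfSpace_re_ge R).isPreconnected.image _ fun u hu =>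
      (hasDerivAt_petal (by have : R ≤ u.re := hu; linarith)).continuousAt.continuousWithinAt
  have hcl : (0 : ℂ) ∈ closure (petal m l '' {u | R ≤ u.re}) := by
    rw [Metric.mem_closure_iff]
    intro η hη
    obtain ⟨R', hR', hR''⟩ := exists_norm_petal_lt hm l hη
    have h1 : R ≤ ((max R R' : ℝ) : ℂ).re := le_max_left _ _
    refine ⟨_, ⟨((max R R' : ℝ) : ℂ), h1, rfl⟩, ?_⟩
    rw [dist_zero_left]
    refine hR'' _ ?_
    rw [Complex.norm_real, Real.norm_eq_abs]
    exact (le_max_right _ _).trans (le_abs_self _)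
  have hS := M.isolated (insert 0 (petal m l '' {u | R ≤ u.re})) ?_
    (hpre.subset_closure (Set.subset_insert _ _)
      (Set.insert_subset hcl subset_closure)) (Set.mem_insert _ _) ?_
  · exact petal_ne_zero m l R (hS (Set.mem_insert_of_mem _ ⟨(R : ℂ), by simp, rfl⟩))
  · rintro z (rfl | ⟨u, hu, rfl⟩)
    · exact Metric.mem_ball_self M.pos
    · exact (hball _ (hmem u hu)).1.2.2
  · rintro z (rfl | ⟨u, hu, rfl⟩)
    · exact M.apply_zero
    · exact hzero u hu

/-- The possible rates of growth: if `P` grows along a holomorphic vector field `H` at a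
constant logarithmic rate `μ` up to a flat error, then `μ = 0`, and `H` is zero or has a centre. -/
theorem logTangent_rigidity (M : FlatModel P ε) (hH : AnalyticAt ℂ H 0) (hP : LogTangent P H μ) :
    μ = 0 ∧ H 0 = 0 ∧ (deriv H 0).re = 0 ∧ (deriv H 0 = 0 → ∀ᶠ z in 𝓝 (0 : ℂ), H z = 0) := by
  have hnH : AnalyticAt ℂ (fun z => -H z) 0 := hH.neg
  have hnd : deriv (fun z => -H z) 0 = -deriv H 0 := deriv.fun_neg
  have h0 := M.vectorField_apply_zero hH hP
  have hre : (deriv H 0).re = 0 := by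
    have h1 := M.re_deriv_not_neg hH h0 hP
    have h2 := M.re_deriv_not_neg hnH (by simp [h0]) hP.neg
    rw [hnd, Complex.neg_re] at h2
    linarith
  have hdeg : deriv H 0 = 0 → ∀ᶠ z in 𝓝 (0 : ℂ), H z = 0 := by
    intro hd
    by_contra hne
    have htop : analyticOrderAt H 0 ≠ ⊤ := fun h => hne (analyticOrderAt_eq_top.1 h)
    obtain ⟨n, hn⟩ := ENat.ne_top_iff_exists.1 htop
    obtain ⟨v, hv, hv0, hev⟩ := (hH.analyticOrderAt_eq_natCast (n := n)).1 hn.symm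
    have hev' : ∀ᶠ z in 𝓝 (0 : ℂ), H z = z ^ n * v z := by simpa using hev
    match n with
    | 0 =>
      have := hev'.self_of_nhds
      rw [h0, pow_zero, one_mul] at this
      exact hv0 this.symm
    | 1 =>
      have h1 : HasDerivAt (fun z : ℂ => z ^ 1 * v z) (v 0) 0 := by
        have : HasDerivAt (fun z : ℂ => z ^ 1 * v z) (1 * v 0 + 0 ^ 1 * deriv v 0) 0 := by
          refine HasDerivAt.mul ?_ hv.differentiableAt.hasDerivAt
          simpa using hasDerivAt_id' (0 : ℂ)
        simpa using this
      rw [EventuallyEq.deriv_eq hev', h1.deriv] at hd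
      exact hv0 hd
    | m + 2 =>
      have h1 := M.not_degenerate hv hv0 (m := m + 1) (by simp) hev' hP
      have h2 := M.not_degenerate hv.neg (by simpa using hv0) (m := m + 1) (by simp)
        (H := fun z => -H z) (hev'.mono fun z hz => by simp [hz]) hP.neg
      linarith
  refine ⟨?_, h0, hre, hdeg⟩
  by_cases hd : deriv H 0 = 0
  · -- here `H = 0` near `0`, so that `μ P` is much smaller than `P`
    by_contra hμ
    refine M.not_eventually_zero ?_
    obtain ⟨C, hC⟩ := hP 1
    have hsmall : ∀ᶠ z in 𝓝 (0 : ℂ), C * ‖z‖ ^ 1 < |μ| := by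
      have : ContinuousAt (fun z : ℂ => C * ‖z‖ ^ 1) 0 := by fun_prop
      refine this.eventually_lt continuousAt_const ?_
      simpa using hμ
    filter_upwards [hC, hdeg hd, hsmall] with z h1 h2 h3
    rw [h2, map_zero, zero_sub, abs_neg, abs_mul] at h1
    by_contra hne
    have := abs_pos.2 hne
    nlinarith
  · have h1 := M.rate_not_pos_of_center hH h0 hd hre hP
    have h2 := M.rate_not_pos_of_center hnH (by simp [h0]) (by rw [hnd]; simpa using hd)
      (by rw [hnd]; simpa using hre) hP.neg
    linarith

end FlatModel

/-! ### Separately holomorphic functions of two variables -/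

/-- `f` is continuous on `U` and holomorphic there in each variable separately. -/
structure SepHolOn (f : ℂ × ℂ → ℂ) (U : Set (ℂ × ℂ)) : Prop where
  continuousOn : ContinuousOn f U
  fst : ∀ p ∈ U, DifferentiableAt ℂ (fun w => f (w, p.2)) p.1
  snd : ∀ p ∈ U, DifferentiableAt ℂ (fun z => f (p.1, z)) p.2

/-- The partial derivative in the first variable. -/
noncomputable def dFst (f : ℂ × ℂ → ℂ) (p : ℂ × ℂ) : ℂ := deriv (fun w => f (w, p.2)) p.1

/-- The partial derivative in the second variable. -/
noncomputable def dSnd (f : ℂ × ℂ → ℂ) (p : ℂ × ℂ) : ℂ := deriv (fun z => f (p.1, z)) p.2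

lemma sepHolOn_of_differentiableOn {f : ℂ × ℂ → ℂ} {U : Set (ℂ × ℂ)} (hU : IsOpen U)
    (hf : DifferentiableOn ℂ f U) : SepHolOn f U where
  continuousOn := hf.continuousOn
  fst p hp := (hf.differentiableAt (hU.mem_nhds hp)).comp p.1
    (differentiableAt_id.prodMk (differentiableAt_const _))
  snd p hp := (hf.differentiableAt (hU.mem_nhds hp)).comp p.2
    ((differentiableAt_const _).prodMk differentiableAt_id)

namespace SepHolOn
variable {f g : ℂ × ℂ → ℂ} {U : Set (ℂ × ℂ)}

lemma mono {V : Set (ℂ × ℂ)} (hf : SepHolOn f U) (h : V ⊆ U) : SepHolOn f V :=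
  ⟨hf.continuousOn.mono h, fun p hp => hf.fst p (h hp), fun p hp => hf.snd p (h hp)⟩

lemma mul (hf : SepHolOn f U) (hg : SepHolOn g U) : SepHolOn (fun p => f p * g p) U :=
  ⟨hf.continuousOn.mul hg.continuousOn, fun p hp => (hf.fst p hp).mul (hg.fst p hp),
    fun p hp => (hf.snd p hp).mul (hg.snd p hp)⟩

lemma sub (hf : SepHolOn f U) (hg : SepHolOn g U) : SepHolOn (fun p => f p - g p) U :=
  ⟨hf.continuousOn.sub hg.continuousOn, fun p hp => (hf.fst p hp).sub (hg.fst p hp),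
    fun p hp => (hf.snd p hp).sub (hg.snd p hp)⟩

lemma div (hf : SepHolOn f U) (hg : SepHolOn g U) (h0 : ∀ p ∈ U, g p ≠ 0) :
    SepHolOn (fun p => f p / g p) U :=
  ⟨hf.continuousOn.div hg.continuousOn h0, fun p hp => (hf.fst p hp).div (hg.fst p hp) (h0 p hp),
    fun p hp => (hf.snd p hp).div (hg.snd p hp) (h0 p hp)⟩

lemma const_mul (c : ℂ) (hf : SepHolOn f U) : SepHolOn (fun p => c * f p) U :=
  ⟨continuousOn_const.mul hf.continuousOn, fun p hp => (hf.fst p hp).const_mul c,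
    fun p hp => (hf.snd p hp).const_mul c⟩

lemma swap (hf : SepHolOn f U) : SepHolOn (fun p => f p.swap) (Prod.swap ⁻¹' U) :=
  ⟨hf.continuousOn.comp continuous_swap.continuousOn fun _ hp => hp,
    fun p hp => hf.snd p.swap hp, fun p hp => hf.fst p.swap hp⟩

/-- Cauchy's estimate for the difference of two slices. -/
lemma continuousOn_dFst (hU : IsOpen U) (hf : SepHolOn f U) : ContinuousOn (dFst f) U := by
  intro p₀ hp₀
  refine ContinuousAt.continuousWithinAt ?_
  obtain ⟨r, hr, hrU⟩ := Metric.nhds_basis_closedBall.mem_iff.1 (hU.mem_nhds hp₀)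
  set δ := r / 2 with hδ
  have hδ0 : 0 < δ := by positivity
  have huc := (isCompact_closedBall p₀ r).uniformContinuousOn_of_continuous
    (hf.continuousOn.mono hrU)
  rw [Metric.uniformContinuousOn_iff] at huc
  rw [Metric.continuousAt_iff]
  intro η hη
  obtain ⟨ρ, hρ, hρ'⟩ := huc (η / 2 * δ) (by positivity)
  refine ⟨min ρ δ, lt_min hρ hδ0, fun p hp => ?_⟩
  have hmem : ∀ q : ℂ × ℂ, dist q p₀ < δ → ∀ s ∈ Metric.closedBall (0 : ℂ) δ,
      (q.1 + s, q.2) ∈ Metric.closedBall p₀ r := by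
    intro q hq s hs
    have h1 : dist (q.1 + s, q.2) q ≤ δ := by
      rw [dist_eq_norm, Prod.norm_def]
      simpa [hδ0.le] using hs
    have := dist_triangle (q.1 + s, q.2) q p₀
    rw [Metric.mem_closedBall]
    linarith
  have hd : ∀ q : ℂ × ℂ, dist q p₀ < δ → ∀ s ∈ Metric.closedBall (0 : ℂ) δ,
      DifferentiableAt ℂ (fun s => f (q.1 + s, q.2)) s := by
    intro q hq s hs
    have h1 := hf.fst _ (hrU (hmem q hq s hs))
    exact DifferentiableAt.comp (g := fun w => f (w, q.2)) s h1 (differentiableAt_id.const_add q.1)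
  have hder : ∀ q : ℂ × ℂ, deriv (fun s => f (q.1 + s, q.2)) 0 = dFst f q := by
    intro q
    rw [dFst, deriv_comp_const_add (f := fun w => f (w, q.2)), add_zero]
  have hp1 : dist p p₀ < δ := hp.trans_le (min_le_right _ _)
  have hp2 : dist p p₀ < ρ := hp.trans_le (min_le_left _ _)
  have h00 : dist p₀ p₀ < δ := by rwa [dist_self]
  have key := Complex.norm_deriv_le_of_forall_mem_sphere_norm_le (c := 0) (C := η / 2 * δ)
    (f := fun s => f (p.1 + s, p.2) - f (p₀.1 + s, p₀.2)) hδ0 ?_ ?_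
  · rw [deriv_fun_sub (hd p hp1 0 (by simp [hδ0.le])) (hd p₀ h00 0 (by simp [hδ0.le])), hder, hder,
      mul_div_cancel_right₀ _ hδ0.ne'] at key
    rw [dist_eq_norm]
    linarith
  · refine DifferentiableOn.diffContOnCl fun s hs => ?_
    rw [closure_ball _ hδ0.ne'] at hs
    exact ((hd p hp1 s hs).sub (hd p₀ h00 s hs)).differentiableWithinAt
  · intro s hs
    have hs' := Metric.sphere_subset_closedBall hs
    rw [← dist_eq_norm]
    refine (hρ' _ (hmem p hp1 s hs') _ (hmem p₀ h00 s hs') ?_).le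
    rw [dist_eq_norm] at hp2 ⊢
    simpa [Prod.norm_def] using hp2

/-- The partial derivative is a locally uniform limit of difference quotients. -/
lemma dFst (hU : IsOpen U) (hf : SepHolOn f U) : SepHolOn (dFst f) U := by
  have hc := hf.continuousOn_dFst hU
  refine ⟨hc, fun p hp => ?_, fun p hp => ?_⟩
  · have hV : IsOpen {w : ℂ | (w, p.2) ∈ U} := hU.preimage (by fun_prop)
    have h1 : DifferentiableOn ℂ (fun w => f (w, p.2)) {w : ℂ | (w, p.2) ∈ U} :=
      fun w hw => (hf.fst (w, p.2) hw).differentiableWithinAt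
    exact (h1.deriv hV).differentiableAt (hV.mem_nhds hp)
  obtain ⟨r, hr, hrU⟩ := Metric.nhds_basis_closedBall.mem_iff.1 (hU.mem_nhds hp)
  have huc := (isCompact_closedBall p r).uniformContinuousOn_of_continuous (hc.mono hrU)
  rw [Metric.uniformContinuousOn_iff] at huc
  have hmem : ∀ s ∈ Metric.ball (0 : ℂ) r, ∀ z ∈ Metric.ball p.2 r,
      (p.1 + s, z) ∈ Metric.closedBall p r := by
    intro s hs z hz
    rw [Metric.mem_closedBall, dist_eq_norm, Prod.norm_def]
    rw [mem_ball_zero_iff] at hs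
    rw [mem_ball_iff_norm] at hz
    simp [hs.le, hz.le]
  have hlim : TendstoUniformlyOn
      (fun (s : ℂ) (z : ℂ) => (f (p.1 + s, z) - f (p.1, z)) / s)
      (fun z => InfiniteTypeModel.dFst f (p.1, z)) (𝓝[≠] 0) (Metric.ball p.2 r) := by
    rw [Metric.tendstoUniformlyOn_iff]
    intro η hη
    obtain ⟨ρ, hρ, hρ'⟩ := huc (η / 2) (by positivity)
    have hb : Metric.ball (0 : ℂ) (min ρ r) ∈ 𝓝[≠] (0 : ℂ) :=
      nhdsWithin_le_nhds (Metric.ball_mem_nhds _ (lt_min hρ hr))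
    filter_upwards [hb, self_mem_nhdsWithin] with s hs hs0 z hz
    have hs0 : s ≠ 0 := hs0
    have hderiv : ∀ x ∈ Metric.ball (0 : ℂ) (min ρ r), HasDerivWithinAt
        (fun x => f (p.1 + x, z) - x * InfiniteTypeModel.dFst f (p.1, z))
        (InfiniteTypeModel.dFst f (p.1 + x, z) - InfiniteTypeModel.dFst f (p.1, z))
        (Metric.ball (0 : ℂ) (min ρ r)) x := by
      intro x hx
      have hx' : x ∈ Metric.ball (0 : ℂ) r := Metric.ball_subset_ball (min_le_right _ _) hx
      have h1 := (hf.fst _ (hrU (hmem x hx' z hz))).hasDerivAt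
      have h2 := h1.comp_const_add p.1 x
      have h3 := (hasDerivAt_id x).mul_const (InfiniteTypeModel.dFst f (p.1, z))
      rw [one_mul] at h3
      exact (h2.sub h3).hasDerivWithinAt
    have key := (convex_ball (0 : ℂ) (min ρ r)).norm_image_sub_le_of_norm_hasDerivWithin_le
      (C := η / 2) hderiv (fun x hx => ?_) (Metric.mem_ball_self (lt_min hρ hr)) hs
    · simp only [add_zero, zero_mul, sub_zero] at key
      rw [dist_comm, dist_eq_norm]
      have h4 : (f (p.1 + s, z) - f (p.1, z)) / s - InfiniteTypeModel.dFst f (p.1, z) =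
          (f (p.1 + s, z) - s * InfiniteTypeModel.dFst f (p.1, z) - f (p.1, z)) / s := by
        field_simp
        ring
      rw [h4, norm_div, div_lt_iff₀ (norm_pos_iff.2 hs0)]
      have := norm_pos_iff.2 hs0
      nlinarith
    · have hx' : x ∈ Metric.ball (0 : ℂ) r := Metric.ball_subset_ball (min_le_right _ _) hx
      rw [← dist_eq_norm]
      have h0 := hmem 0 (Metric.mem_ball_self hr) z hz
      rw [add_zero] at h0
      refine (hρ' _ (hmem x hx' z hz) _ h0 ?_).le
      have := Metric.ball_subset_ball (min_le_left _ _) hx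
      rw [dist_eq_norm, Prod.norm_def]
      simpa [hρ] using this
  have hdiff := hlim.tendstoLocallyUniformlyOn.differentiableOn (U := Metric.ball p.2 r) ?_
    Metric.isOpen_ball
  · exact hdiff.differentiableAt (Metric.ball_mem_nhds _ hr)
  · filter_upwards [nhdsWithin_le_nhds (Metric.ball_mem_nhds (0 : ℂ) hr)] with s hs z hz
    have h0 := hmem 0 (Metric.mem_ball_self hr) z hz
    rw [add_zero] at h0
    have h1 := hf.snd _ (hrU (hmem s hs z hz))
    have h2 := hf.snd _ (hrU h0)
    exact ((h1.sub h2).div_const s).differentiableWithinAt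

lemma dSnd (hU : IsOpen U) (hf : SepHolOn f U) : SepHolOn (dSnd f) U :=
  (hf.swap.dFst (hU.preimage continuous_swap)).swap

/-- The increments in the first variable are controlled by the partial derivative. -/
lemma norm_sub_le {R C : ℝ} (hf : SepHolOn f U) (hU : Metric.ball 0 R ⊆ U)
    (hC : ∀ p ∈ Metric.ball (0 : ℂ × ℂ) R, ‖InfiniteTypeModel.dFst f p‖ ≤ C) {w w' z : ℂ}
    (hw : ‖w‖ < R) (hw' : ‖w'‖ < R) (hz : ‖z‖ < R) : ‖f (w', z) - f (w, z)‖ ≤ C * ‖w' - w‖ := by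
  have hmem : ∀ x ∈ Metric.ball (0 : ℂ) R, (x, z) ∈ Metric.ball (0 : ℂ × ℂ) R := fun x hx => by
    rw [mem_ball_zero_iff] at hx ⊢
    exact max_lt hx hz
  exact (convex_ball (0 : ℂ) R).norm_image_sub_le_of_norm_hasDerivWithin_le
    (f := fun x => f (x, z)) (f' := fun x => InfiniteTypeModel.dFst f (x, z))
    (fun x hx => ((hf.fst _ (hU (hmem x hx))).hasDerivAt).hasDerivWithinAt)
    (fun x hx => hC _ (hmem x hx)) (mem_ball_zero_iff.2 hw) (mem_ball_zero_iff.2 hw')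

end SepHolOn

/-- A holomorphic function on a disc that vanishes on the imaginary axis vanishes. -/
lemma eq_zero_of_imaginary_axis {f : ℂ → ℂ} {R : ℝ}
    (hf : ∀ w ∈ Metric.ball (0 : ℂ) R, DifferentiableAt ℂ f w)
    (h0 : ∀ t : ℝ, |t| < R → f (t * Complex.I) = 0) : ∀ w ∈ Metric.ball (0 : ℂ) R, f w = 0 := by
  intro w hw
  have hR : 0 < R := (norm_nonneg w).trans_lt (mem_ball_zero_iff.1 hw)
  have han : AnalyticOnNhd ℂ f (Metric.ball 0 R) := DifferentiableOn.analyticOnNhd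
    (fun w hw => (hf w hw).differentiableWithinAt) Metric.isOpen_ball
  refine han.eqOn_zero_of_preconnected_of_frequently_eq_zero (convex_ball _ _).isPreconnected
    (Metric.mem_ball_self hR) ?_ hw
  have h1 : Tendsto (fun t : ℝ => (t : ℂ) * Complex.I) (𝓝[>] 0) (𝓝[≠] 0) := by
    refine tendsto_nhdsWithin_iff.2 ⟨?_, ?_⟩
    · have : Continuous fun t : ℝ => (t : ℂ) * Complex.I := by fun_prop
      have := this.tendsto 0
      simp only [Complex.ofReal_zero, zero_mul] at this
      exact this.mono_left nhdsWithin_le_nhds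
    · filter_upwards [self_mem_nhdsWithin] with t ht
      have ht : 0 < t := ht
      simp [ht.ne']
  refine h1.frequently (Eventually.frequently ?_)
  filter_upwards [self_mem_nhdsWithin, nhdsWithin_le_nhds (Metric.ball_mem_nhds (0 : ℝ) hR)]
    with t ht ht'
  exact h0 t (by simpa using ht')

/-! ### Holomorphic vector fields tangent to the hypersurface -/

lemma mul_exp_of_re_nonpos_mem_ball {ζ l : ℂ} {s r : ℝ} (hl : l.re ≤ 0) (hs : 0 ≤ s)
    (hζ : ζ ∈ Metric.ball (0 : ℂ) r) : ζ * Complex.exp (l * s) ∈ Metric.ball (0 : ℂ) r := by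
  rw [mem_ball_zero_iff, norm_mul_exp]
  refine lt_of_le_of_lt (mul_le_of_le_one_right (norm_nonneg _) ?_) (mem_ball_zero_iff.1 hζ)
  rw [Real.exp_le_one_iff]
  exact mul_nonpos_of_nonpos_of_nonneg hl hs

/-- Rotating by a purely imaginary exponential carries `z` to `‖z‖` at some positive time. -/
lemma exists_mul_exp_eq_norm {l : ℂ} (hre : l.re = 0) (hl : l ≠ 0) (z : ℂ) :
    ∃ s : ℝ, 0 ≤ s ∧ z * Complex.exp (l * s) = ((‖z‖ : ℝ) : ℂ) := by
  have him : l.im ≠ 0 := fun h => hl (Complex.ext (by simpa using hre) (by simpa using h))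
  have hl' : l = l.im * Complex.I := by apply Complex.ext <;> simp [hre]
  have him' : (l.im : ℂ) ≠ 0 := by exact_mod_cast him
  have h1 := Complex.neg_pi_lt_arg z
  have h2 := Complex.arg_le_pi z
  have hpi := Real.pi_pos
  have key : ∀ n : ℤ, z * Complex.exp (l * (((n * (2 * Real.pi) - z.arg) / l.im : ℝ) : ℂ)) =
      ((‖z‖ : ℝ) : ℂ) := by
    intro n
    have h3 : l * (((n * (2 * Real.pi) - z.arg) / l.im : ℝ) : ℂ) =
        n * (2 * Real.pi * Complex.I) - z.arg * Complex.I := by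
      rw [hl']
      push_cast
      simp
      field_simp
    rw [h3, Complex.exp_sub, Complex.exp_int_mul_two_pi_mul_I]
    rw [mul_one_div, div_eq_iff (Complex.exp_ne_zero _)]
    exact (Complex.norm_mul_exp_arg_mul_I z).symm
  rcases lt_or_gt_of_ne him with h | h
  · refine ⟨_, ?_, key (-1)⟩
    refine div_nonneg_of_nonpos ?_ h.le
    push_cast
    linarith
  · refine ⟨_, ?_, key 1⟩
    refine div_nonneg ?_ h.le
    push_cast
    linarith

namespace FlatModel
variable {P : ℂ → ℝ} {ε : ℝ}

/-- If `h (-P) H` annihilates `P`, where `H` has a centre, then on the level `P = Q` the function `P`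
is constant along the integral curves of the holomorphic vector field `h (-Q) H`. They are closed,
for otherwise they would spiral into `0`; in a linearizing coordinate they are circles. -/
theorem rotationallySymmetricable_of_center (M : FlatModel P ε) {H h : ℂ → ℂ}
    (hH : AnalyticAt ℂ H 0) (h0 : H 0 = 0) (hd : deriv H 0 ≠ 0) (hre : (deriv H 0).re = 0)
    (hh : AnalyticAt ℂ h 0) (hh0 : h 0 = 1)
    (hP : ∀ᶠ z in 𝓝 (0 : ℂ), fderiv ℝ P z (h (-(P z : ℂ)) * H z) = 0) :
    RotationallySymmetricable P := by
  obtain ⟨φ, hφ, hφ0, hφ1, hlin⟩ := exists_linearization hH h0 hd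
  have hφ1' : deriv φ 0 ≠ 0 := by rw [hφ1]; exact one_ne_zero
  set l := deriv H 0 with hldef
  have hφt := tendsto_zero_of_analyticAt hφ hφ0
  -- `h` is Lipschitz near `0`, with some constant `K`
  have hcd : ContDiffAt ℂ 1 h 0 := hh.contDiffAt
  obtain ⟨K, V, hV, hK⟩ := hcd.exists_lipschitzOnWith
  have hPt : Tendsto (fun z => -(P z : ℂ)) (𝓝 0) (𝓝 0) := by
    have := (Complex.continuous_ofReal.tendsto 0).comp M.flat.tendsto
    simpa using this.neg
  have hbd : ∀ᶠ z in 𝓝 (0 : ℂ), ‖fderiv ℝ P z‖ * ‖H z‖ ≤ 1 := by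
    have h1 : Tendsto (fun z => ‖fderiv ℝ P z‖ * ‖H z‖) (𝓝 0) (𝓝 0) := by
      simpa using M.flat_fderiv.tendsto.norm.mul (tendsto_zero_of_analyticAt hH h0).norm
    exact (h1.eventually_lt_const one_pos).mono fun z hz => hz.le
  have hhne : ∀ᶠ z in 𝓝 (0 : ℂ), h (-(P z : ℂ)) ≠ 0 :=
    hPt.eventually (hh.continuousAt.eventually_ne (by rw [hh0]; exact one_ne_zero))
  obtain ⟨r, hr, hball⟩ := Metric.eventually_nhds_iff_ball.1
    (((hφt.eventually hP).and (hφt.eventually M.ball_mem)).and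
      (((hφt.eventually hbd).and (hφt.eventually (hPt.eventually hV))).and
        (hlin.and (hφ.eventually_analyticAt.and (hφt.eventually hhne)))))
  have hconst : ∀ ζ ∈ Metric.ball (0 : ℂ) r, ∀ σ : ℝ,
      ((σ : ℂ) * h (-(P (φ ζ) : ℂ)) * l).re ≤ 0 → ∀ T : ℝ, 0 ≤ T →
      P (φ (ζ * Complex.exp ((σ : ℂ) * h (-(P (φ ζ) : ℂ)) * l * T))) = P (φ ζ) := by
    intro ζ hζ σ hσ T hT
    set a : ℂ := (σ : ℂ) * h (-(P (φ ζ) : ℂ)) with ha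
    have hmem : ∀ s ∈ Set.Icc 0 T, ζ * Complex.exp (a * l * s) ∈ Metric.ball (0 : ℂ) r :=
      fun s hs => mul_exp_of_re_nonpos_mem_ball hσ hs.1 hζ
    have hder : ∀ s ∈ Set.Icc 0 T, HasDerivAt
        (fun s : ℝ => P (φ (ζ * Complex.exp (a * l * s))) - P (φ ζ))
        (fderiv ℝ P (φ (ζ * Complex.exp (a * l * s))) (a * H (φ (ζ * Complex.exp (a * l * s))))) s :=
      fun s hs => by
        have hb := hball _ (hmem s hs)
        refine (M.hasDerivAt_comp (hasDerivAt_linearized (H := fun z => a * H z)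
          hb.2.2.2.1.differentiableAt ?_) hb.1.2).sub_const _
        rw [hb.2.2.1]
        ring
    have hz := eq_zero_of_abs_deriv_le_mul_abs_self_of_eq_zero_right (a := 0) (b := T)
      (K := |σ| * K) (fun s hs => (hder s hs).continuousAt.continuousWithinAt)
      (fun s hs => (hder s (Set.Ico_subset_Icc_self hs)).hasDerivWithinAt) (by simp)
      (fun s hs => ?_) T ⟨hT, le_rfl⟩
    · exact sub_eq_zero.1 hz
    · have hb := hball _ (hmem s (Set.Ico_subset_Icc_self hs))
      set z := φ (ζ * Complex.exp (a * l * s)) with hzdef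
      have e1 : a * H z = ((σ : ℝ) • (h (-(P z : ℂ)) * H z)) +
          (σ : ℝ) • ((h (-(P (φ ζ) : ℂ)) - h (-(P z : ℂ))) * H z) := by
        rw [Complex.real_smul, Complex.real_smul, ha]; ring
      rw [e1, map_add, map_smul, hb.1.1, smul_zero, zero_add, map_smul, norm_smul, mul_assoc,
        Real.norm_eq_abs]
      refine mul_le_mul_of_nonneg_left ?_ (abs_nonneg σ)
      have h2 := hK.norm_sub_le (hball ζ hζ).2.1.2 hb.2.1.2
      have h3 : ‖-(P (φ ζ) : ℂ) - -(P z : ℂ)‖ = ‖P z - P (φ ζ)‖ := by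
        rw [neg_sub_neg, ← Complex.ofReal_sub, Complex.norm_real]
      rw [h3] at h2
      calc ‖fderiv ℝ P z ((h (-(P (φ ζ) : ℂ)) - h (-(P z : ℂ))) * H z)‖
          ≤ ‖fderiv ℝ P z‖ * ‖(h (-(P (φ ζ) : ℂ)) - h (-(P z : ℂ))) * H z‖ :=
            (fderiv ℝ P z).le_opNorm _
        _ = ‖h (-(P (φ ζ) : ℂ)) - h (-(P z : ℂ))‖ * (‖fderiv ℝ P z‖ * ‖H z‖) := by
            rw [norm_mul]; ring
        _ ≤ (K * ‖P z - P (φ ζ)‖) * 1 := by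
            gcongr
            exact hb.2.1.1
        _ = _ := mul_one _
  -- a curve spiralling into `0` would force `P = P 0 = 0` on it
  have hspiral : ∀ ζ ∈ Metric.ball (0 : ℂ) r, ∀ σ : ℝ,
      ¬ ((σ : ℂ) * h (-(P (φ ζ) : ℂ)) * l).re < 0 := by
    intro ζ hζ σ hneg
    have hlim : Tendsto (fun T : ℝ => ζ * Complex.exp ((σ : ℂ) * h (-(P (φ ζ) : ℂ)) * l * T)) atTop
        (𝓝 0) := by
      rw [tendsto_zero_iff_norm_tendsto_zero]
      simp only [norm_mul_exp]
      rw [← mul_zero ‖ζ‖]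
      exact (Real.tendsto_exp_atBot.comp
        ((tendsto_const_mul_atBot_of_neg hneg).2 tendsto_id)).const_mul _
    have h1 := (M.flat.tendsto.comp hφt).comp hlim
    have h2 : P (φ ζ) = 0 := by
      refine tendsto_nhds_unique (tendsto_const_nhds.congr' ?_) h1
      filter_upwards [eventually_ge_atTop 0] with T hT
      exact (hconst ζ hζ σ hneg.le T hT).symm
    rw [h2] at hneg
    simp [hh0, hre] at hneg
  refine ⟨φ, hφ, hφ0, hφ1', ?_⟩
  filter_upwards [Metric.ball_mem_nhds _ hr] with z hz
  have hzero : (h (-(P (φ z) : ℂ)) * l).re = 0 := by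
    have h1 := hspiral z hz 1
    have h2 := hspiral z hz (-1)
    simp only [Complex.ofReal_one, one_mul, Complex.ofReal_neg, neg_mul, Complex.neg_re] at h1 h2
    linarith
  obtain ⟨s, hs, hs'⟩ := exists_mul_exp_eq_norm hzero
    (mul_ne_zero (hball z hz).2.2.2.2 hd) z
  have h1 := hconst z hz 1 (by rw [Complex.ofReal_one, one_mul]; exact hzero.le) s hs
  rw [Complex.ofReal_one, one_mul, hs'] at h1
  exact h1.symm

/-- A holomorphic vector field `(Y₁, Y₂)` tangent to the hypersurface `Re z₁ + P z₂ = 0` is an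
imaginary multiple of the translation field, unless `P` is rotationally symmetricable. Flatness of
`P` forces `Y₁` to depend on `z₁` only; then each slice `Y₂ (i t, ·)` moves `P` at the logarithmic
rate `Re ∂₁Y₁ (i t, 0)`. By `logTangent_rigidity` all these rates are zero, and the slices, if not
zero, are real multiples of one field with a centre. -/
theorem tangent_rigidity (M : FlatModel P ε) (hrot : ¬ RotationallySymmetricable P)
    {Y₁ Y₂ : ℂ × ℂ → ℂ} {U : Set (ℂ × ℂ)} (hU : U ∈ 𝓝 (0 : ℂ × ℂ))
    (hY₁ : SepHolOn Y₁ U) (hY₂ : SepHolOn Y₂ U)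
    (htan : ∀ᶠ q in 𝓝 (0 : ℝ × ℂ), (Y₁ (q.1 * Complex.I - P q.2, q.2)).re +
      fderiv ℝ P q.2 (Y₂ (q.1 * Complex.I - P q.2, q.2)) = 0) :
    ∃ c : ℝ, ∀ᶠ p in 𝓝 (0 : ℂ × ℂ), Y₁ p = c * Complex.I ∧ Y₂ p = 0 := by
  obtain ⟨r₀, hr₀, hr₀U⟩ := Metric.mem_nhds_iff.1 hU
  have hB : IsOpen (Metric.ball (0 : ℂ × ℂ) r₀) := Metric.isOpen_ball
  replace hY₁ := hY₁.mono hr₀U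
  replace hY₂ := hY₂.mono hr₀U
  -- bounds for the derivatives in the first variable
  obtain ⟨C, hC0, hC⟩ : ∃ C : ℝ, 0 ≤ C ∧ ∀ᶠ p in 𝓝 (0 : ℂ × ℂ),
      ‖dFst Y₁ p‖ ≤ C ∧ ‖dFst Y₂ p‖ ≤ C ∧ ‖Y₂ p‖ ≤ C := by
    have hm := hB.mem_nhds (Metric.mem_ball_self hr₀)
    have h1 := ((hY₁.dFst hB).continuousOn.continuousAt hm).norm
    have h2 := ((hY₂.dFst hB).continuousOn.continuousAt hm).norm
    have h3 := (hY₂.continuousOn.continuousAt hm).norm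
    refine ⟨‖dFst Y₁ 0‖ + ‖dFst Y₂ 0‖ + ‖Y₂ 0‖ + 1, by positivity, ?_⟩
    have n1 := norm_nonneg (dFst Y₁ 0)
    have n2 := norm_nonneg (dFst Y₂ 0)
    have n3 := norm_nonneg (Y₂ 0)
    filter_upwards [h1.eventually_lt_const (lt_add_one _), h2.eventually_lt_const (lt_add_one _),
      h3.eventually_lt_const (lt_add_one _)] with p a1 a2 a3
    exact ⟨by linarith, by linarith, by linarith⟩
  obtain ⟨r₁, hr₁, hr₁'⟩ := Metric.eventually_nhds_iff_ball.1 (hC.and (hB.mem_nhds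
    (Metric.mem_ball_self hr₀)))
  obtain ⟨r₂, hr₂, hr₂'⟩ := Metric.eventually_nhds_iff_ball.1 htan
  have hPt := M.flat.tendsto
  set R := min (r₁ / 2) r₂ with hR
  have hR0 : 0 < R := by positivity
  have hR1 : 2 * R ≤ r₁ := by have := min_le_left (r₁ / 2) r₂; linarith
  have hR2 : R ≤ r₂ := min_le_right _ _
  have hsub : Metric.ball (0 : ℂ × ℂ) (2 * R) ⊆ Metric.ball 0 r₀ := fun p hp =>
    (hr₁' p (Metric.ball_subset_ball hR1 hp)).2
  have hCb : ∀ p ∈ Metric.ball (0 : ℂ × ℂ) (2 * R),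
      ‖dFst Y₁ p‖ ≤ C ∧ ‖dFst Y₂ p‖ ≤ C ∧ ‖Y₂ p‖ ≤ C := fun p hp =>
    (hr₁' p (Metric.ball_subset_ball hR1 hp)).1
  have hmem : ∀ w z : ℂ, ‖w‖ < 2 * R → ‖z‖ < 2 * R → (w, z) ∈ Metric.ball (0 : ℂ × ℂ) (2 * R) :=
    fun w z hw hz => mem_ball_zero_iff.2 (max_lt hw hz)
  have htI : ∀ t : ℝ, ‖(t : ℂ) * Complex.I‖ = |t| := fun t => by simp
  have hPsmall : ∀ᶠ z in 𝓝 (0 : ℂ), |P z| < R := by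
    have := hPt.abs
    rw [abs_zero] at this
    exact this.eventually_lt_const hR0
  have hwb : ∀ t : ℝ, |t| < R → ∀ z : ℂ, |P z| < R → ‖(t : ℂ) * Complex.I - P z‖ < 2 * R := by
    intro t ht z hz
    have := norm_sub_le ((t : ℂ) * Complex.I) (P z)
    rw [htI, Complex.norm_real, Real.norm_eq_abs] at this
    linarith
  have htan' : ∀ t : ℝ, |t| < R → ∀ᶠ z in 𝓝 (0 : ℂ), (Y₁ (t * Complex.I - P z, z)).re +
      fderiv ℝ P z (Y₂ (t * Complex.I - P z, z)) = 0 := by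
    intro t ht
    filter_upwards [Metric.ball_mem_nhds (0 : ℂ) hr₂] with z hz
    refine hr₂' (t, z) ?_
    rw [mem_ball_zero_iff] at hz ⊢
    exact max_lt (by rw [Real.norm_eq_abs]; linarith) hz
  have hzR : ∀ᶠ z in 𝓝 (0 : ℂ), ‖z‖ < R := by
    filter_upwards [Metric.ball_mem_nhds (0 : ℂ) hR0] with z hz
    exact mem_ball_zero_iff.1 hz
  have hsl₁ : ∀ w : ℂ, ‖w‖ < R → ∀ z : ℂ, ‖z‖ < R → DifferentiableAt ℂ (fun z => Y₁ (w, z)) z :=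
    fun w hw z hz => hY₁.snd _ (hsub (hmem w z (by linarith) (by linarith)))
  have hsl₂ : ∀ w : ℂ, ‖w‖ < R → ∀ z : ℂ, ‖z‖ < R → DifferentiableAt ℂ (fun z => Y₂ (w, z)) z :=
    fun w hw z hz => hY₂.snd _ (hsub (hmem w z (by linarith) (by linarith)))
  have han : ∀ {u : ℂ → ℂ}, (∀ z : ℂ, ‖z‖ < R → DifferentiableAt ℂ u z) →
      AnalyticOnNhd ℂ u (Metric.ball 0 R) := fun hu => DifferentiableOn.analyticOnNhd
    (fun z hz => (hu z (mem_ball_zero_iff.1 hz)).differentiableWithinAt) Metric.isOpen_ball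
  have h0b : (0 : ℂ) ∈ Metric.ball (0 : ℂ) R := Metric.mem_ball_self hR0
  have hpc : IsPreconnected (Metric.ball (0 : ℂ) R) := (convex_ball _ _).isPreconnected
  -- the first component depends on the first variable only
  have hY₁t : ∀ t : ℝ, |t| < R → (Y₁ (t * Complex.I, 0)).re = 0 ∧
      ∀ z : ℂ, ‖z‖ < R → Y₁ (t * Complex.I, z) = Y₁ (t * Complex.I, 0) := by
    intro t ht
    have htR : ‖(t : ℂ) * Complex.I‖ < R := by rwa [htI]
    have hu := han (hsl₁ _ htR)
    have hflat : Flat fun z => (Y₁ (t * Complex.I, z)).re := by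
      intro N
      refine Asymptotics.IsBigO.trans ?_
        ((((M.flat_fderiv N).norm_left.const_mul_left C)).add
          ((M.flat N).norm_left.const_mul_left C))
      refine Asymptotics.IsBigO.of_bound 1 ?_
      filter_upwards [htan' t ht, hPsmall, hzR] with z h1 h2 h3
      have hb := hwb t ht z h2
      have h4 := hY₁.norm_sub_le hsub (fun p hp => (hCb p hp).1) (w := t * Complex.I)
        (w' := t * Complex.I - P z) (z := z) (by linarith) hb (by linarith)
      have h5 := (fderiv ℝ P z).le_opNorm (Y₂ (t * Complex.I - P z, z))
      have h6 := (hCb _ (hmem _ z hb (by linarith))).2.2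
      have h7 := (Complex.abs_re_le_norm _).trans h4
      rw [sub_sub_cancel_left, norm_neg, Complex.norm_real, Complex.sub_re] at h7
      have h8 : ‖fderiv ℝ P z‖ * ‖Y₂ (t * Complex.I - P z, z)‖ ≤ ‖fderiv ℝ P z‖ * C := by gcongr
      rw [Real.norm_eq_abs] at h5 ⊢
      rw [one_mul]
      refine le_trans ?_ (le_abs_self _)
      rw [abs_le] at h5 h7 ⊢
      constructor <;> linarith [h5.1, h5.2, h7.1, h7.2]
    obtain ⟨h1, h2⟩ := eventually_eq_of_flat_re (hu 0 h0b) hflat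
    exact ⟨h1, fun z hz => hu.eqOn_of_preconnected_of_eventuallyEq analyticOnNhd_const hpc h0b h2
      (mem_ball_zero_iff.2 hz)⟩
  set A : ℂ → ℂ := fun w => Y₁ (w, 0) with hA
  have hAd : ∀ w : ℂ, ‖w‖ < 2 * R → DifferentiableAt ℂ A w := fun w hw =>
    hY₁.fst (w, 0) (hsub (hmem w 0 hw (by simpa using hR0)))
  have hY₁A : ∀ w z : ℂ, ‖w‖ < 2 * R → ‖z‖ < R → Y₁ (w, z) = A w := by
    intro w z hw hz
    have han2 : AnalyticOnNhd ℂ (fun w => Y₁ (w, z) - A w) (Metric.ball 0 (2 * R)) := by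
      refine DifferentiableOn.analyticOnNhd (fun w hw => ?_) Metric.isOpen_ball
      have hw' := mem_ball_zero_iff.1 hw
      exact ((hY₁.fst (w, z) (hsub (hmem w z hw' (by linarith)))).sub
        (hAd w hw')).differentiableWithinAt
    have hev : (fun w => Y₁ (w, z) - A w) =ᶠ[𝓝 0] 0 := by
      filter_upwards [Metric.ball_mem_nhds (0 : ℂ) hR0] with w hw
      refine eq_zero_of_imaginary_axis (f := fun w => Y₁ (w, z) - A w) (fun w hw => ?_) (fun t ht => ?_)
        w hw
      · have hw' := mem_ball_zero_iff.1 hw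
        exact (hY₁.fst (w, z) (hsub (hmem w z (by linarith) (by linarith)))).sub
          (hAd w (by linarith))
      · exact sub_eq_zero.2 ((hY₁t t ht).2 z hz)
    exact sub_eq_zero.1 (han2.eqOn_zero_of_preconnected_of_eventuallyEq_zero
      (convex_ball _ _).isPreconnected (Metric.mem_ball_self (by positivity)) hev
      (mem_ball_zero_iff.2 hw))
  -- each slice of the second component moves `P` at a constant logarithmic rate
  have hlog : ∀ t : ℝ, |t| < R → LogTangent P (fun z => Y₂ (t * Complex.I, z))
      (deriv A (t * Complex.I)).re := by
    intro t ht N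
    have htR : ‖(t : ℂ) * Complex.I‖ < R := by rwa [htI]
    have hAan : AnalyticAt ℂ A (t * Complex.I) := DifferentiableOn.analyticAt
      (s := Metric.ball 0 (2 * R))
      (fun w hw => (hAd w (mem_ball_zero_iff.1 hw)).differentiableWithinAt)
      (Metric.isOpen_ball.mem_nhds (mem_ball_zero_iff.2 (by linarith)))
    have hB' : AnalyticAt ℂ (fun x => A (t * Complex.I + x) - A (t * Complex.I)) 0 := by
      refine AnalyticAt.sub ?_ analyticAt_const
      refine AnalyticAt.comp_of_eq (g := A) (y := t * Complex.I) hAan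
        (analyticAt_const.add analyticAt_id) (by simp)
    obtain ⟨k, hk, hk0, hkA⟩ := exists_eq_mul_of_analyticAt hB' (by simp)
    have hk0' : k 0 = deriv A (t * Complex.I) := by
      rw [hk0, deriv_sub_const, deriv_comp_const_add, add_zero]
    have hkO : (fun x => k x - k 0) =O[𝓝 0] fun x : ℂ => x := by
      simpa using hk.differentiableAt.isBigO_sub
    obtain ⟨D, hD⟩ := hkO.bound
    obtain ⟨C₁, hC₁⟩ := (M.flat N).bound
    obtain ⟨C₂, hC₂⟩ := (M.flat_fderiv N).bound
    have hPc : Tendsto (fun z => -(P z : ℂ)) (𝓝 0) (𝓝 0) := by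
      have := (Complex.continuous_ofReal.tendsto 0).comp hPt
      simpa using this.neg
    refine ⟨|D| * C₁ + C * C₂, ?_⟩
    filter_upwards [htan' t ht, hPsmall, hzR, hPc.eventually hkA, hPc.eventually hD, hC₁, hC₂]
      with z h1 h2 h3 h4 h5 h6 h7
    have hb := hwb t ht z h2
    rw [hY₁A _ z hb h3] at h1
    have h4' : A (t * Complex.I - P z) = A (t * Complex.I) - P z * k (-(P z)) := by
      rw [sub_eq_add_neg]; linear_combination h4
    rw [h4', Complex.sub_re, (hY₁t t ht).1, Complex.re_ofReal_mul] at h1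
    have h8 := hY₂.norm_sub_le hsub (fun p hp => (hCb p hp).2.1) (w := t * Complex.I - P z)
      (w' := t * Complex.I) (z := z) hb (by linarith) (by linarith)
    rw [sub_sub_cancel, Complex.norm_real] at h8
    rw [norm_neg, Complex.norm_real] at h5
    rw [norm_pow, norm_norm] at h6 h7
    have e : fderiv ℝ P z (Y₂ (t * Complex.I, z)) - (deriv A (t * Complex.I)).re * P z =
        fderiv ℝ P z (Y₂ (t * Complex.I, z) - Y₂ (t * Complex.I - P z, z)) +
          P z * (k (-(P z)) - k 0).re := by
      rw [map_sub, Complex.sub_re, hk0']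
      linear_combination h1
    rw [e]
    have h9 := ((fderiv ℝ P z).le_opNorm (Y₂ (t * Complex.I, z) - Y₂ (t * Complex.I - P z, z)))
    have h10 := (Complex.abs_re_le_norm (k (-(P z)) - k 0)).trans h5
    rw [Real.norm_eq_abs] at h6 h8 h9 h10
    calc _ ≤ |fderiv ℝ P z (Y₂ (t * Complex.I, z) - Y₂ (t * Complex.I - P z, z))| +
          |P z * (k (-(P z)) - k 0).re| := abs_add_le _ _
      _ ≤ (C₂ * ‖z‖ ^ N) * (C * |P z|) + |P z| * (|D| * (C₁ * ‖z‖ ^ N)) := by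
          rw [abs_mul]
          refine add_le_add (h9.trans (mul_le_mul h7 h8 (norm_nonneg _) ?_)) ?_
          · exact (norm_nonneg _).trans h7
          · refine mul_le_mul_of_nonneg_left (h10.trans ?_) (abs_nonneg _)
            exact mul_le_mul (le_abs_self D) h6 (abs_nonneg _) (abs_nonneg _)
      _ = _ := by ring
  have hslan : ∀ t : ℝ, |t| < R → AnalyticOnNhd ℂ (fun z => Y₂ (t * Complex.I, z))
      (Metric.ball 0 R) := fun t ht => han (hsl₂ _ (by rwa [htI]))
  have hrig := fun (t : ℝ) (ht : |t| < R) => M.logTangent_rigidity (hslan t ht 0 h0b) (hlog t ht)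
  -- hence the first component is constant
  have hA' : ∀ w ∈ Metric.ball (0 : ℂ) R, deriv A w = 0 := by
    have hAon : DifferentiableOn ℂ A (Metric.ball 0 (2 * R)) :=
      fun w hw => (hAd w (mem_ball_zero_iff.1 hw)).differentiableWithinAt
    refine eq_zero_of_imaginary_axis (fun w hw => ?_) fun t ht => ?_
    · exact (hAon.deriv Metric.isOpen_ball).differentiableAt (Metric.isOpen_ball.mem_nhds
        (mem_ball_zero_iff.2 (by have := mem_ball_zero_iff.1 hw; linarith)))
    · refine Complex.ext (hrig t ht).1 ?_
      have h1 : HasDerivAt (fun s : ℝ => (s : ℂ) * Complex.I) Complex.I t := by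
        simpa using (Complex.ofRealCLM.hasDerivAt (x := t)).mul_const Complex.I
      have h2 : HasDerivAt (fun s : ℝ => A (s * Complex.I)) (deriv A (t * Complex.I) * Complex.I) t :=
        HasDerivAt.comp (h₂ := A) t (hAd (t * Complex.I) (by rw [htI]; linarith)).hasDerivAt h1
      have h3 := Complex.reCLM.hasFDerivAt.comp_hasDerivAt t h2
      have h4 : HasDerivAt (fun s : ℝ => (A (s * Complex.I)).re) 0 t := by
        refine (hasDerivAt_const t (0 : ℝ)).congr_of_eventuallyEq ?_
        filter_upwards [continuous_abs.continuousAt.eventually_lt_const ht] with s hs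
        exact (hY₁t s hs).1
      have h5 := h3.unique h4
      simpa using h5
  have hAc : ∀ w : ℂ, ‖w‖ < R → A w = A 0 := fun w hw =>
    Metric.isOpen_ball.is_const_of_deriv_eq_zero hpc
      (fun w hw => (hAd w (by have := mem_ball_zero_iff.1 hw; linarith)).differentiableWithinAt)
      hA' (mem_ball_zero_iff.2 hw) h0b
  have hA0 : A 0 = (A 0).im * Complex.I := by
    have := (hY₁t 0 (by simpa using hR0)).1
    simp only [Complex.ofReal_zero, zero_mul] at this
    apply Complex.ext <;> simp [hA, this]
  set lam : ℂ → ℂ := fun w => dSnd Y₂ (w, 0) with hlam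
  have hlamd : ∀ w : ℂ, ‖w‖ < R → DifferentiableAt ℂ lam w := fun w hw =>
    (hY₂.dSnd hB).fst (w, 0) (hsub (hmem w 0 (by linarith) (by simpa using hR0)))
  have hlog0 : ∀ t : ℝ, |t| < R → LogTangent P (fun z => Y₂ (t * Complex.I, z)) 0 := fun t ht => by
    have := hlog t ht
    rwa [(hrig t ht).1] at this
  -- the slices are real multiples of one another
  have hall : ∀ t₀ : ℝ, |t₀| < R → lam (t₀ * Complex.I) = 0 := by
    intro t₀ ht₀
    by_contra hne
    refine hrot ?_
    set H : ℂ → ℂ := fun z => Y₂ (t₀ * Complex.I, z) with hH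
    have hdH : deriv H 0 = lam (t₀ * Complex.I) := rfl
    set h : ℂ → ℂ := fun w => lam w / lam (t₀ * Complex.I) with hhdef
    have hslice : ∀ t : ℝ, |t| < R → ∀ z : ℂ, ‖z‖ < R →
        Y₂ (t * Complex.I, z) = h (t * Complex.I) * H z := by
      intro t ht z hz
      set κ : ℝ := (lam (t * Complex.I)).im / (lam (t₀ * Complex.I)).im with hκ
      have hre : (lam (t * Complex.I)).re = 0 := (hrig t ht).2.2.1
      have hre₀ : (lam (t₀ * Complex.I)).re = 0 := (hrig t₀ ht₀).2.2.1
      have him₀ : (lam (t₀ * Complex.I)).im ≠ 0 := fun h => hne (Complex.ext hre₀ h)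
      have hκl : lam (t * Complex.I) = κ * lam (t₀ * Complex.I) := by
        apply Complex.ext
        · simp [hre, hre₀]
        · simp [hκ, him₀]
      have hD : AnalyticOnNhd ℂ (fun z => Y₂ (t * Complex.I, z) - κ * H z) (Metric.ball 0 R) :=
        (hslan t ht).sub (analyticOnNhd_const.mul (hslan t₀ ht₀))
      have hd0 : deriv (fun z => Y₂ (t * Complex.I, z) - κ * H z) 0 = 0 := by
        have e1 := (hslan t ht 0 h0b).differentiableAt.hasDerivAt
        have e2 := ((hslan t₀ ht₀ 0 h0b).differentiableAt.hasDerivAt).const_mul (κ : ℂ)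
        have e3 : HasDerivAt (fun z => Y₂ (t * Complex.I, z) - κ * H z)
            (lam (t * Complex.I) - κ * lam (t₀ * Complex.I)) 0 := e1.sub e2
        rw [e3.deriv]
        exact sub_eq_zero.2 hκl
      have hev := (M.logTangent_rigidity (hD 0 h0b)
        ((hlog0 t ht).sub_smul (hlog0 t₀ ht₀) κ)).2.2.2 hd0
      have := hD.eqOn_zero_of_preconnected_of_eventuallyEq_zero hpc h0b hev (mem_ball_zero_iff.2 hz)
      have h2 : h (t * Complex.I) = κ := by
        rw [hhdef]
        simp only
        rw [hκl, mul_div_cancel_right₀ _ hne]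
      rw [h2]
      exact sub_eq_zero.1 this
    have hprod : ∀ w z : ℂ, ‖w‖ < R → ‖z‖ < R → Y₂ (w, z) = h w * H z := by
      intro w z hw hz
      have := eq_zero_of_imaginary_axis (f := fun w => Y₂ (w, z) - h w * H z) (R := R)
        (fun w hw => ?_) (fun t ht => sub_eq_zero.2 (hslice t ht z hz)) w (mem_ball_zero_iff.2 hw)
      · exact sub_eq_zero.1 this
      · have hw' := mem_ball_zero_iff.1 hw
        exact (hY₂.fst (w, z) (hsub (hmem w z (by linarith) (by linarith)))).sub
          (((hlamd w hw').div_const _).mul_const _)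
    have hhan : AnalyticAt ℂ h (t₀ * Complex.I) := DifferentiableOn.analyticAt
      (s := Metric.ball 0 R)
      (fun w hw => ((hlamd w (mem_ball_zero_iff.1 hw)).div_const _).differentiableWithinAt)
      (Metric.isOpen_ball.mem_nhds (mem_ball_zero_iff.2 (by rwa [htI])))
    refine M.rotationallySymmetricable_of_center (H := H) (h := fun x => h (t₀ * Complex.I + x))
      (hslan t₀ ht₀ 0 h0b) (hrig t₀ ht₀).2.1 hne (hrig t₀ ht₀).2.2.1 ?_ ?_ ?_
    · exact AnalyticAt.comp_of_eq (g := h) (y := t₀ * Complex.I) hhan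
        (analyticAt_const.add analyticAt_id) (by simp)
    · simp [hhdef, hne]
    · have hsm : ∀ᶠ z in 𝓝 (0 : ℂ), |P z| < R - |t₀| := by
        have := hPt.abs
        rw [abs_zero] at this
        exact this.eventually_lt_const (by linarith)
      filter_upwards [htan' t₀ ht₀, hzR, hsm] with z h1 h2 h3
      have h4 : ‖(t₀ : ℂ) * Complex.I - P z‖ < R := by
        have := norm_sub_le ((t₀ : ℂ) * Complex.I) (P z)
        rw [htI, Complex.norm_real, Real.norm_eq_abs] at this
        linarith
      rw [hY₁A _ z (by linarith) h2, hAc _ h4, hA0, hprod _ z h4 h2] at h1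
      rw [← sub_eq_add_neg]
      simpa using h1
  refine ⟨(A 0).im, ?_⟩
  filter_upwards [Metric.ball_mem_nhds (0 : ℂ × ℂ) hR0] with p hp
  have hp' := mem_ball_zero_iff.1 hp
  have hp1 : ‖p.1‖ < R := (le_max_left _ _).trans_lt hp'
  have hp2 : ‖p.2‖ < R := (le_max_right _ _).trans_lt hp'
  refine ⟨(hY₁A p.1 p.2 (by linarith) hp2).trans ((hAc _ hp1).trans hA0), ?_⟩
  refine eq_zero_of_imaginary_axis (f := fun w => Y₂ (w, p.2)) (fun w hw => ?_) (fun t ht => ?_)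
    p.1 (mem_ball_zero_iff.2 hp1)
  · have hw' := mem_ball_zero_iff.1 hw
    exact hY₂.fst (w, p.2) (hsub (hmem w p.2 (by linarith) (by linarith)))
  · exact (hslan t ht).eqOn_zero_of_preconnected_of_eventuallyEq_zero hpc h0b
      ((hrig t ht).2.2.2 (hall t ht)) (mem_ball_zero_iff.2 hp2)

end FlatModel

/-! ### Plane topology -/

lemma _root_.IsPreconnected.subset_interior_of_disjoint_frontier {X : Type*} [TopologicalSpace X]
    {S U : Set X} (hS : IsPreconnected S) (hne : (S ∩ interior U).Nonempty)
    (hd : Disjoint S (frontier U)) : S ⊆ interior U := by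
  refine hS.subset_left_of_subset_union isOpen_interior isClosed_closure.isOpen_compl
    (v := (closure U)ᶜ) ?_ ?_ hne
  · exact Set.disjoint_compl_right_iff_subset.2 (interior_subset.trans subset_closure)
  · intro x hx
    by_cases h : x ∈ closure U
    · by_contra h2
      exact Set.disjoint_left.1 hd hx ⟨h, fun h3 => h2 (Or.inl h3)⟩
    · exact Or.inr h

lemma frontier_connectedComponentIn_subset {X : Type*} [TopologicalSpace X]
    [LocallyConnectedSpace X] {F : Set X} (hF : IsOpen F) (x : X) :
    frontier (connectedComponentIn F x) ⊆ frontier F := by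
  intro p hp
  have ho : IsOpen (connectedComponentIn F x) := hF.connectedComponentIn
  rw [ho.frontier_eq] at hp
  rw [hF.frontier_eq]
  refine ⟨closure_mono (connectedComponentIn_subset F x) hp.1, fun hpF => hp.2 ?_⟩
  obtain ⟨q, hq1, hq2⟩ := mem_closure_iff.1 hp.1 _ (hF.connectedComponentIn (x := p))
    (mem_connectedComponentIn hpF)
  rw [connectedComponentIn_eq hq2, ← connectedComponentIn_eq hq1]
  exact mem_connectedComponentIn hpF

lemma _root_.IsClosed.isClosed_connectedComponentIn {X : Type*} [TopologicalSpace X] {F : Set X}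
    (hF : IsClosed F) {x : X} (hx : x ∈ F) : IsClosed (connectedComponentIn F x) := by
  refine isClosed_of_closure_subset ?_
  exact isPreconnected_connectedComponentIn.closure.subset_connectedComponentIn
    (subset_closure (mem_connectedComponentIn hx))
    (closure_minimal (connectedComponentIn_subset F x) hF)

lemma isPreconnected_compl_closedBall {r : ℝ} (hr : 0 < r) :
    IsPreconnected (Metric.closedBall (0 : ℂ) r)ᶜ := by
  have h : (Metric.closedBall (0 : ℂ) r)ᶜ = Complex.exp '' {w | Real.log r < w.re} := by
    ext z
    simp only [Set.mem_compl_iff, mem_closedBall_zero_iff, not_le, Set.mem_image, Set.mem_ofPred_eq]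
    constructor
    · intro hz
      have hz0 : z ≠ 0 := norm_pos_iff.1 (hr.trans hz)
      exact ⟨Complex.log z, by rw [Complex.log_re]; exact Real.log_lt_log hr hz,
        Complex.exp_log hz0⟩
    · rintro ⟨w, hw, rfl⟩
      rw [Complex.norm_exp]
      rwa [← Real.log_lt_iff_lt_exp hr]
  rw [h]
  exact (convex_halfSpace_re_gt _).isPreconnected.image _ Complex.continuous_exp.continuousOn

/-- The plane is unicoherent: two closed connected sets covering it have connected intersection. If
`S` and `T` separated the intersection, the function equal to `exp (iπφ)` on `A` and to `exp (-iπφ)`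
on `B`, with `φ = 0` on `S` and `φ = 1` on `T`, would have no continuous logarithm. -/
theorem isPreconnected_inter_of_union_eq_univ {A B : Set ℂ} (hA : IsClosed A) (hB : IsClosed B)
    (hAc : IsPreconnected A) (hBc : IsPreconnected B) (hAB : A ∪ B = Set.univ) :
    IsPreconnected (A ∩ B) := by
  rw [isPreconnected_closed_iff]
  intro S T hS hT hST ⟨x, hx, hxS⟩ ⟨y, hy, hyT⟩
  by_contra hne
  have hdisj : Disjoint (A ∩ B ∩ S) (A ∩ B ∩ T) := by
    rw [Set.disjoint_left]
    intro z hz hz'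
    exact hne ⟨z, hz.1, hz.2, hz'.2⟩
  obtain ⟨φ, hφS, hφT, -⟩ := exists_continuous_zero_one_of_isClosed
    ((hA.inter hB).inter hS) ((hA.inter hB).inter hT) hdisj
  classical
  have hagree : ∀ z ∈ A ∩ B, Complex.exp (Real.pi * φ z * Complex.I) =
      Complex.exp (-(Real.pi * φ z * Complex.I)) := by
    intro z hz
    rcases hST hz with h | h
    · have : φ z = 0 := hφS ⟨hz, h⟩
      simp [this]
    · have : φ z = 1 := hφT ⟨hz, h⟩
      simp [this, Complex.exp_neg]
  have hcφ : Continuous fun z : ℂ => (Real.pi * φ z * Complex.I : ℂ) := by fun_prop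
  set f : ℂ → ℂ := A.piecewise (fun z => Complex.exp (Real.pi * φ z * Complex.I))
    (fun z => Complex.exp (-(Real.pi * φ z * Complex.I))) with hf
  have hfc : Continuous f := by
    refine continuous_piecewise (fun z hz => hagree z ⟨hA.frontier_subset hz, ?_⟩)
      hcφ.cexp.continuousOn hcφ.neg.cexp.continuousOn
    rw [frontier_eq_closure_inter_closure] at hz
    refine closure_minimal ?_ hB hz.2
    intro w hw
    exact (hAB.ge (Set.mem_univ w)).resolve_left hw
  have hfA : ∀ z ∈ A, f z = Complex.exp (Real.pi * φ z * Complex.I) := fun z hz =>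
    Set.piecewise_eq_of_mem _ _ _ hz
  have hfB : ∀ z ∈ B, f z = Complex.exp (-(Real.pi * φ z * Complex.I)) := fun z hz => by
    by_cases hzA : z ∈ A
    · rw [hfA z hzA, hagree z ⟨hzA, hz⟩]
    · exact Set.piecewise_eq_of_notMem _ _ _ hzA
  have hf0 : ∀ z, f z ≠ 0 := fun z => by
    rcases hAB.ge (Set.mem_univ z) with h | h
    · rw [hfA z h]; exact Complex.exp_ne_zero _
    · rw [hfB z h]; exact Complex.exp_ne_zero _
  have hφx : φ x = 0 := hφS ⟨hx, hxS⟩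
  have hφy : φ y = 1 := hφT ⟨hy, hyT⟩
  obtain ⟨F, ⟨hFx, hF⟩, -⟩ := Complex.isCoveringMapOn_exp.existsUnique_continuousMap_lifts ⟨f, hfc⟩
    (a₀ := x) (e₀ := 0) (by simp [hfA x hx.1, hφx]) (fun z => hf0 z)
  have hF' : ∀ z, Complex.exp (F z) = f z := fun z => congrFun hF z
  -- lifts of the same function that agree at `x` agree on connected sets
  have huniq : ∀ {D : Set ℂ} (_ : IsPreconnected D) (_ : x ∈ D) (_ : y ∈ D) (u : ℂ → ℂ)
      (_ : Continuous u) (_ : u x = 0) (_ : ∀ z ∈ D, f z = Complex.exp (u z)), F y = u y := by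
    intro D hD hxD hyD u hu hux hfu
    have h1 := Complex.isCoveringMap_exp.eqOn_of_comp_eqOn hD F.continuous.continuousOn
      hu.continuousOn (fun z hz => Subtype.ext ((hF' z).trans (hfu z hz))) hxD (hFx.trans hux.symm)
    exact h1 hyD
  have e1 := huniq hAc hx.1 hy.1 _ hcφ (by simp [hφx]) hfA
  have e2 := huniq hBc hx.2 hy.2 _ hcφ.neg (by simp [hφx]) hfB
  rw [e1, hφy] at e2
  have h3 : (Real.pi : ℂ) * Complex.I = 0 := by
    have : (Real.pi : ℂ) * Complex.I = -(Real.pi * Complex.I) := by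
      simpa only [Pi.neg_apply, hφy, Complex.ofReal_one, mul_one] using e2
    linear_combination (1 / 2) * this
  simp [Real.pi_ne_zero] at h3

/-- Filling the holes of the closure of the component of `0` in a bounded open set gives a compact
connected set. Its boundary is contained in the original one, and is connected by unicoherence. -/
lemma exists_filled {V : Set ℂ} (hV : IsOpen V) (h0 : (0 : ℂ) ∈ V) {r : ℝ} (hr : 0 < r)
    (hVr : V ⊆ Metric.closedBall 0 r) : ∃ K : Set ℂ, IsCompact K ∧ IsPreconnected K ∧
      (0 : ℂ) ∈ interior K ∧ IsPreconnected (frontier K) ∧ frontier K ⊆ frontier V ∧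
      K ⊆ Metric.closedBall 0 r := by
  set W := connectedComponentIn V 0 with hW
  have hWo : IsOpen W := hV.connectedComponentIn
  have hWc : IsPreconnected W := isPreconnected_connectedComponentIn
  have h0W : (0 : ℂ) ∈ W := mem_connectedComponentIn h0
  set D := closure W with hD
  have hDr : D ⊆ Metric.closedBall 0 r :=
    closure_minimal ((connectedComponentIn_subset V 0).trans hVr) Metric.isClosed_closedBall
  have hDo : IsOpen Dᶜ := isClosed_closure.isOpen_compl
  have hx₀ : ((2 * r : ℝ) : ℂ) ∈ (Metric.closedBall (0 : ℂ) r)ᶜ := by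
    rw [Set.mem_compl_iff, mem_closedBall_zero_iff, Complex.norm_real, Real.norm_eq_abs,
      abs_of_pos (by positivity)]
    linarith
  -- the unbounded component of the complement
  set O := connectedComponentIn Dᶜ ((2 * r : ℝ) : ℂ) with hO
  have hOo : IsOpen O := hDo.connectedComponentIn
  have hOD : O ⊆ Dᶜ := connectedComponentIn_subset _ _
  have hrO : (Metric.closedBall (0 : ℂ) r)ᶜ ⊆ O :=
    (isPreconnected_compl_closedBall hr).subset_connectedComponentIn hx₀
      (Set.compl_subset_compl.2 hDr)
  have hDK : D ⊆ Oᶜ := Set.subset_compl_comm.1 hOD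
  have hKr : Oᶜ ⊆ Metric.closedBall (0 : ℂ) r := Set.compl_subset_comm.1 hrO
  have hKc : IsClosed Oᶜ := hOo.isClosed_compl
  have h0D : (0 : ℂ) ∈ D := subset_closure h0W
  have hDc : IsPreconnected D := hWc.closure
  have hKpre : IsPreconnected Oᶜ := by
    refine isPreconnected_of_forall 0 fun x hx => ?_
    by_cases hxD : x ∈ D
    · exact ⟨D, hDK, h0D, hxD, hDc⟩
    set C := connectedComponentIn Dᶜ x with hC
    have hxC : x ∈ C := mem_connectedComponentIn hxD
    have hCO : Disjoint C O := by
      rw [Set.disjoint_left]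
      intro z hz hzO
      apply hx
      rw [hO, connectedComponentIn_eq hzO, ← connectedComponentIn_eq hz]
      exact hxC
    have hCne : C ≠ Set.univ := fun h => by
      have := connectedComponentIn_subset Dᶜ x (h.ge (Set.mem_univ (0 : ℂ)))
      exact this h0D
    obtain ⟨y, hy⟩ := nonempty_frontier_iff.2 ⟨⟨x, hxC⟩, hCne⟩
    have hyD : y ∈ D := by
      have := frontier_connectedComponentIn_subset hDo x hy
      rw [frontier_compl] at this
      exact isClosed_closure.frontier_subset this
    have h1 : IsPreconnected (insert y C) :=
      isPreconnected_connectedComponentIn.subset_closure (Set.subset_insert _ _)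
        (Set.insert_subset (frontier_subset_closure hy) subset_closure)
    refine ⟨insert y C ∪ D, ?_, Or.inr h0D, Or.inl (Set.mem_insert_of_mem _ hxC),
      h1.union y (Set.mem_insert _ _) hyD hDc⟩
    refine Set.union_subset (Set.insert_subset (hDK hyD) ?_) hDK
    exact fun z hz hzO => Set.disjoint_left.1 hCO hz hzO
  have hfr : frontier Oᶜ ⊆ frontier W := by
    rw [frontier_compl]
    intro p hp
    have hpD : p ∈ D := by
      have := frontier_connectedComponentIn_subset hDo _ hp
      rw [frontier_compl] at this
      exact isClosed_closure.frontier_subset this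
    rw [hWo.frontier_eq]
    refine ⟨hpD, fun hpW => ?_⟩
    obtain ⟨q, hq1, hq2⟩ := mem_closure_iff.1 (frontier_subset_closure hp) W hWo hpW
    exact hOD hq2 (subset_closure hq1)
  refine ⟨Oᶜ, (isCompact_closedBall (0 : ℂ) r).of_isClosed_subset hKc hKr, hKpre, ?_, ?_,
    hfr.trans (frontier_connectedComponentIn_subset hV 0), hKr⟩
  · exact interior_maximal (subset_closure.trans hDK) hWo h0W
  · have h1 : frontier Oᶜ = closure O ∩ Oᶜ := by
      rw [frontier_compl, hOo.frontier_eq, Set.sdiff_eq]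
    rw [h1]
    refine isPreconnected_inter_of_union_eq_univ isClosed_closure hKc
      isPreconnected_connectedComponentIn.closure hKpre ?_
    exact Set.eq_univ_of_forall fun z => by
      by_cases hz : z ∈ O
      · exact Or.inl (subset_closure hz)
      · exact Or.inr hz

/-- If `{0}` is a connected component of a compact set, then `0` has arbitrarily small neighbourhoods
whose boundary misses the compact set. -/
lemma exists_isOpen_disjoint_frontier {Z : Set ℂ} (hZ : IsCompact Z) (h0 : (0 : ℂ) ∈ Z)
    (hc : ∀ S ⊆ Z, IsPreconnected S → (0 : ℂ) ∈ S → S ⊆ {0}) {r : ℝ} (hr : 0 < r) :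
    ∃ V : Set ℂ, IsOpen V ∧ (0 : ℂ) ∈ V ∧ V ⊆ Metric.ball 0 r ∧ Disjoint (frontier V) Z := by
  have : CompactSpace Z := isCompact_iff_compactSpace.1 hZ
  set z₀ : Z := ⟨0, h0⟩ with hz₀
  have hcomp : connectedComponent z₀ ⊆ {z₀} := by
    intro x hx
    have h1 := hc (Subtype.val '' connectedComponent z₀) (by rintro _ ⟨y, -, rfl⟩; exact y.2)
      (isPreconnected_connectedComponent.image _ continuous_subtype_val.continuousOn)
      ⟨z₀, mem_connectedComponent, rfl⟩ ⟨x, hx, rfl⟩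
    exact Subtype.ext h1
  rw [connectedComponent_eq_iInter_isClopen] at hcomp
  have : Nonempty {s : Set Z // IsClopen s ∧ z₀ ∈ s} :=
    ⟨⟨Set.univ, isClopen_univ, Set.mem_univ _⟩⟩
  have hdir : Directed (· ⊇ ·) fun s : {s : Set Z // IsClopen s ∧ z₀ ∈ s} => (s : Set Z) :=
    fun s t => ⟨⟨s ∩ t, s.2.1.inter t.2.1, s.2.2, t.2.2⟩, Set.inter_subset_left,
      Set.inter_subset_right⟩
  obtain ⟨⟨s, hs, hs0⟩, hsU⟩ := exists_subset_nhds_of_compactSpace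
    (U := {x : Z | ‖(x : ℂ)‖ < r}) hdir (fun s => s.2.1.isClosed) (fun x hx => by
      have hx' : x = z₀ := hcomp hx
      rw [hx']
      refine (isOpen_lt (by fun_prop) continuous_const).mem_nhds ?_
      simpa [hz₀] using hr)
  have hA : IsCompact (Subtype.val '' s : Set ℂ) :=
    hs.isClosed.isCompact.image continuous_subtype_val
  have hB : IsCompact (Subtype.val '' sᶜ : Set ℂ) :=
    hs.compl.isClosed.isCompact.image continuous_subtype_val
  have hAB : Disjoint (Subtype.val '' s : Set ℂ) (Subtype.val '' sᶜ) :=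
    Set.disjoint_image_of_injective Subtype.val_injective disjoint_compl_right
  obtain ⟨V₁, V₂, hV₁, hV₂, hAV, hBV, hd⟩ := SeparatedNhds.of_isCompact_isCompact hA hB hAB
  refine ⟨V₁ ∩ Metric.ball 0 r, hV₁.inter Metric.isOpen_ball,
    ⟨hAV ⟨z₀, hs0, rfl⟩, Metric.mem_ball_self hr⟩, Set.inter_subset_right, ?_⟩
  rw [Set.disjoint_left]
  intro p hp hpZ
  rw [(hV₁.inter Metric.isOpen_ball).frontier_eq] at hp
  by_cases hps : (⟨p, hpZ⟩ : Z) ∈ s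
  · exact hp.2 ⟨hAV ⟨_, hps, rfl⟩, mem_ball_zero_iff.2 (hsU hps)⟩
  · have h1 : p ∈ V₂ := hBV ⟨⟨p, hpZ⟩, hps, rfl⟩
    obtain ⟨q, hq1, hq2⟩ := mem_closure_iff.1 hp.1 V₂ hV₂ h1
    exact Set.disjoint_left.1 hd hq2.1 hq1

/-- A holomorphic map sending a compact neighbourhood of its fixed point `0` into its interior is
contracting at `0`: the iterates of `(1 + τ) g` stay in `K`, so their derivatives at `0` are bounded
by Cauchy's estimate. -/
lemma norm_deriv_lt_one_of_mapsTo_interior {g : ℂ → ℂ} {K : Set ℂ} (hK : IsCompact K)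
    (h0 : (0 : ℂ) ∈ interior K) (hg : ∀ z ∈ K, DifferentiableAt ℂ g z) (hg0 : g 0 = 0)
    (hmap : ∀ z ∈ K, g z ∈ interior K) : ‖deriv g 0‖ < 1 := by
  have h0K : (0 : ℂ) ∈ K := interior_subset h0
  have hgK : IsCompact (g '' K) :=
    hK.image_of_continuousOn fun z hz => (hg z hz).continuousAt.continuousWithinAt
  obtain ⟨δ, hδ, hδK⟩ := hgK.exists_cthickening_subset_open isOpen_interior
    (by rintro _ ⟨z, hz, rfl⟩; exact hmap z hz)
  obtain ⟨B, hB⟩ := hgK.isBounded.exists_norm_le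
  obtain ⟨B', hB'⟩ := hK.isBounded.exists_norm_le
  have hB0 : 0 ≤ B := (norm_nonneg _).trans (hB _ ⟨0, h0K, rfl⟩)
  set τ := δ / (B + 1) with hτ
  have hτ0 : 0 < τ := by positivity
  set G : ℂ → ℂ := fun z => ((1 + τ : ℝ) : ℂ) * g z with hG
  have hGK : ∀ z ∈ K, G z ∈ K := by
    intro z hz
    refine interior_subset (hδK (Metric.mem_cthickening_of_dist_le _ (g z) _ _ ⟨z, hz, rfl⟩ ?_))
    have h1 : G z - g z = (τ : ℂ) * g z := by simp only [hG]; push_cast; ring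
    rw [dist_eq_norm, h1, norm_mul, Complex.norm_real, Real.norm_of_nonneg hτ0.le, hτ,
      div_mul_eq_mul_div, div_le_iff₀ (by positivity)]
    have := hB _ ⟨z, hz, rfl⟩
    nlinarith
  have hGd : ∀ z ∈ K, DifferentiableAt ℂ G z := fun z hz => (hg z hz).const_mul _
  have hit : ∀ n : ℕ, ∀ z ∈ K, G^[n] z ∈ K ∧ DifferentiableAt ℂ G^[n] z := by
    intro n
    induction n with
    | zero => exact fun z hz => ⟨hz, differentiableAt_id⟩
    | succ n ih =>
      intro z hz
      obtain ⟨h1, h2⟩ := ih z hz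
      rw [Function.iterate_succ']
      exact ⟨hGK _ h1, (hGd _ h1).comp z h2⟩
  obtain ⟨ρ, hρ, hρK⟩ := Metric.nhds_basis_closedBall.mem_iff.1 (mem_interior_iff_mem_nhds.1 h0)
  have hbound : ∀ n : ℕ, ((1 + τ) * ‖deriv g 0‖) ^ n ≤ B' / ρ := by
    intro n
    have h1 := Complex.norm_deriv_le_of_forall_mem_sphere_norm_le (f := G^[n]) (c := 0) hρ
      (DifferentiableOn.diffContOnCl fun z hz => by
        rw [closure_ball _ hρ.ne'] at hz
        exact ((hit n z (hρK hz)).2).differentiableWithinAt)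
      (fun z hz => hB' _ (hit n z (hρK (Metric.sphere_subset_closedBall hz))).1)
    have h2 : HasDerivAt G (((1 + τ : ℝ) : ℂ) * deriv g 0) 0 := ((hg 0 h0K).hasDerivAt).const_mul _
    have h3 := (HasDerivAt.iterate (hf := h2) (hx := by simp [hG, hg0]) (n := n)).deriv
    rw [h3, norm_pow, norm_mul, Complex.norm_real, Real.norm_of_nonneg (by positivity)] at h1
    exact h1
  have h1 : (1 + τ) * ‖deriv g 0‖ ≤ 1 := by
    by_contra! h
    obtain ⟨n, hn⟩ := ((tendsto_pow_atTop_atTop_of_one_lt h).eventually_gt_atTop (B' / ρ)).exists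
    exact absurd (hbound n) (not_le.2 hn)
  by_contra! h
  nlinarith

/-! ### Holomorphic maps multiplying `P` by a constant -/

lemma exists_analytic_inverse {g : ℂ → ℂ} (hg : AnalyticAt ℂ g 0) (h0 : g 0 = 0)
    (hd : deriv g 0 ≠ 0) : ∃ k : ℂ → ℂ, AnalyticAt ℂ k 0 ∧ k 0 = 0 ∧ deriv k 0 = (deriv g 0)⁻¹ ∧
      (∀ᶠ z in 𝓝 (0 : ℂ), g (k z) = z) ∧ ∀ᶠ z in 𝓝 (0 : ℂ), k (g z) = z := by
  have h1 := hg.analyticAt_localInverse hd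
  have h2 : hg.hasStrictDerivAt.localInverse _ _ _ hd (g 0) = 0 :=
    HasStrictFDerivAt.localInverse_apply_image ..
  have h3 := hg.hasStrictDerivAt.eventually_right_inverse hd
  have h4 := hg.hasStrictDerivAt.eventually_left_inverse hd
  have h5 := (hg.hasStrictDerivAt.to_localInverse hd).hasDerivAt.deriv
  rw [h0] at h1 h2 h3 h5
  exact ⟨_, h1, h2, h5, h3, h4⟩

namespace FlatModel
variable {P : ℂ → ℝ} {ε : ℝ} {g : ℂ → ℂ} {c : ℝ}

/-- Along the iterates of a contraction `P` would decay at most exponentially, contradicting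
flatness. -/
lemma not_norm_deriv_lt_one (M : FlatModel P ε) (hg : AnalyticAt ℂ g 0) (h0 : g 0 = 0)
    (hc : c ≠ 0) (hP : ∀ᶠ z in 𝓝 (0 : ℂ), P (g z) = c * P z) : ¬ ‖deriv g 0‖ < 1 := by
  intro hlt
  obtain ⟨ρ, hρ, hρ1⟩ := exists_between hlt
  have hρ0 : 0 < ρ := (norm_nonneg _).trans_lt hρ
  obtain ⟨N, hN⟩ := exists_pow_lt_of_lt_one (abs_pos.2 hc) hρ1
  obtain ⟨D, hD⟩ := (M.flat N).bound
  have hcontr : ∀ᶠ z in 𝓝 (0 : ℂ), ‖g z‖ ≤ ρ * ‖z‖ := by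
    obtain ⟨k, hk, hk0, hgk⟩ := exists_eq_mul_of_analyticAt hg h0
    rw [← hk0] at hρ
    filter_upwards [hgk, hk.continuousAt.norm.eventually_lt_const hρ] with z h1 h2
    rw [h1, norm_mul, mul_comm]
    gcongr
  obtain ⟨r, hr, hball⟩ := Metric.eventually_nhds_iff_ball.1 (hcontr.and (hP.and hD))
  refine M.not_eventually_zero ?_
  filter_upwards [Metric.ball_mem_nhds (0 : ℂ) hr] with z hz
  have hit : ∀ n : ℕ, ‖g^[n] z‖ ≤ ρ ^ n * ‖z‖ ∧ P (g^[n] z) = c ^ n * P z := by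
    intro n
    induction n with
    | zero => simp
    | succ n ih =>
      have hb : g^[n] z ∈ Metric.ball (0 : ℂ) r := by
        rw [mem_ball_zero_iff] at hz ⊢
        exact (ih.1.trans (mul_le_of_le_one_left (norm_nonneg _)
          (pow_le_one₀ hρ0.le hρ1.le))).trans_lt hz
      obtain ⟨h1, h2, -⟩ := hball _ hb
      rw [Function.iterate_succ_apply']
      refine ⟨?_, by rw [h2, ih.2]; ring⟩
      calc _ ≤ ρ * ‖g^[n] z‖ := h1
        _ ≤ ρ * (ρ ^ n * ‖z‖) := by gcongr; exact ih.1
        _ = _ := by ring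
  have hD0 : 0 ≤ D * ‖z‖ ^ N := by
    have := (hball z hz).2.2
    rw [norm_pow, norm_norm] at this
    exact (norm_nonneg _).trans this
  have key : ∀ n : ℕ, |P z| ≤ D * ‖z‖ ^ N * (ρ ^ N / |c|) ^ n := by
    intro n
    have hb : g^[n] z ∈ Metric.ball (0 : ℂ) r := by
      rw [mem_ball_zero_iff] at hz ⊢
      exact ((hit n).1.trans (mul_le_of_le_one_left (norm_nonneg _)
        (pow_le_one₀ hρ0.le hρ1.le))).trans_lt hz
    have h1 := (hball _ hb).2.2
    rw [(hit n).2, Real.norm_eq_abs, abs_mul, abs_pow, norm_pow, norm_norm] at h1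
    rw [div_pow, mul_div_assoc', le_div_iff₀ (pow_pos (abs_pos.2 hc) n), mul_comm]
    rcases eq_or_ne z 0 with rfl | hz0
    · rw [M.apply_zero]
      simp only [abs_zero, mul_zero]
      positivity
    have hDnn : 0 ≤ D := nonneg_of_mul_nonneg_left hD0 (by positivity)
    calc _ ≤ D * ‖g^[n] z‖ ^ N := h1
      _ ≤ D * (ρ ^ n * ‖z‖) ^ N := by gcongr; exact (hit n).1
      _ = _ := by ring
  have hlim : Tendsto (fun n : ℕ => D * ‖z‖ ^ N * (ρ ^ N / |c|) ^ n) atTop (𝓝 0) := by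
    have := tendsto_pow_atTop_nhds_zero_of_lt_one (r := ρ ^ N / |c|) (by positivity)
      ((div_lt_one (abs_pos.2 hc)).2 hN)
    simpa using this.const_mul (D * ‖z‖ ^ N)
  exact abs_nonpos_iff.1 (ge_of_tendsto' hlim key)

/-- There are arbitrarily small neighbourhoods of `0` with no zeros of `P` on their boundary. -/
lemma exists_isOpen_frontier_ne_zero (M : FlatModel P ε) {r : ℝ} (hr : 0 < r) (hrε : r < ε) :
    ∃ V : Set ℂ, IsOpen V ∧ (0 : ℂ) ∈ V ∧ V ⊆ Metric.closedBall 0 r ∧ ∀ z ∈ frontier V, P z ≠ 0 := by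
  have hsub : Metric.closedBall (0 : ℂ) r ⊆ Metric.ball 0 ε := Metric.closedBall_subset_ball hrε
  have hcont : ContinuousOn P (Metric.closedBall 0 r) := fun z hz =>
    (M.continuousAt (hsub hz)).continuousWithinAt
  have hZ : IsCompact (Metric.closedBall (0 : ℂ) r ∩ P ⁻¹' {0}) :=
    (isCompact_closedBall (0 : ℂ) r).of_isClosed_subset
      (hcont.preimage_isClosed_of_isClosed Metric.isClosed_closedBall isClosed_singleton)
      Set.inter_subset_left
  obtain ⟨V, hV, h0V, hVr, hd⟩ := exists_isOpen_disjoint_frontier hZ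
    ⟨Metric.mem_closedBall_self hr.le, M.apply_zero⟩
    (fun S hS hSc h0S => M.isolated S (fun z hz => hsub (hS hz).1) hSc h0S fun z hz => (hS hz).2) hr
  have hVr' := hVr.trans Metric.ball_subset_closedBall
  refine ⟨V, hV, h0V, hVr', fun z hz hz0 => Set.disjoint_left.1 hd hz ⟨?_, hz0⟩⟩
  exact closure_minimal hVr' Metric.isClosed_closedBall (frontier_subset_closure hz)

/-- If `|c| < 1`, then `g` maps a component of a sublevel set of `|P|` into its interior, so `g` is
a contraction. -/
lemma not_abs_lt_one (M : FlatModel P ε) (hg : AnalyticAt ℂ g 0) (h0 : g 0 = 0)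
    (hc : c ≠ 0) (hP : ∀ᶠ z in 𝓝 (0 : ℂ), P (g z) = c * P z) : ¬ |c| < 1 := by
  intro hc1
  obtain ⟨r₀, hr₀, hball⟩ := Metric.eventually_nhds_iff_ball.1
    (hP.and (hg.eventually_analyticAt.and M.ball_mem))
  have hr : 0 < min r₀ ε / 2 := by have := M.pos; positivity
  have hrε : min r₀ ε / 2 < ε := by have := min_le_right r₀ ε; have := M.pos; linarith
  have hrr : min r₀ ε / 2 < r₀ := by have := min_le_left r₀ ε; linarith
  obtain ⟨V, hV, h0V, hVr, hVz⟩ := M.exists_isOpen_frontier_ne_zero hr hrε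
  set r := min r₀ ε / 2 with hrdef
  have hcl : closure V ⊆ Metric.closedBall 0 r := closure_minimal hVr Metric.isClosed_closedBall
  have hclb : closure V ⊆ Metric.ball 0 r₀ := hcl.trans (Metric.closedBall_subset_ball hrr)
  have hclε : closure V ⊆ Metric.ball 0 ε := hcl.trans (Metric.closedBall_subset_ball hrε)
  have hclc : IsCompact (closure V) :=
    (isCompact_closedBall (0 : ℂ) r).of_isClosed_subset isClosed_closure hcl
  have hPc : ContinuousOn P (closure V) := fun z hz => (M.continuousAt (hclε hz)).continuousWithinAt
  obtain ⟨δ, hδ, hδV⟩ : ∃ δ : ℝ, 0 < δ ∧ ∀ z ∈ frontier V, δ < |P z| := by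
    have hfc : IsCompact (frontier V) :=
      hclc.of_isClosed_subset isClosed_frontier frontier_subset_closure
    rcases (frontier V).eq_empty_or_nonempty with h | h
    · exact ⟨1, one_pos, by simp [h]⟩
    · obtain ⟨x, hx, hmin⟩ := hfc.exists_isMinOn h (hPc.mono frontier_subset_closure).abs
      have := abs_pos.2 (hVz x hx)
      exact ⟨|P x| / 2, by positivity, fun z hz => by
        have h2 := isMinOn_iff.1 hmin z hz
        linarith⟩
  set F := closure V ∩ {z | |P z| ≤ δ} with hF
  have h0F : (0 : ℂ) ∈ F := ⟨subset_closure h0V, by simp [M.apply_zero, hδ.le]⟩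
  have hFc : IsClosed F := hPc.abs.preimage_isClosed_of_isClosed isClosed_closure isClosed_Iic
  set K := connectedComponentIn F 0 with hK
  have hKF : K ⊆ F := connectedComponentIn_subset F 0
  have hKc : IsCompact K := hclc.of_isClosed_subset (hFc.isClosed_connectedComponentIn h0F)
    (hKF.trans Set.inter_subset_left)
  have h0K : (0 : ℂ) ∈ K := mem_connectedComponentIn h0F
  have hKpre : IsPreconnected K := isPreconnected_connectedComponentIn
  have hgd : ∀ z ∈ K, DifferentiableAt ℂ g z := fun z hz =>
    (hball z (hclb (hKF hz).1)).2.1.differentiableAt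
  have hgP : ∀ z ∈ K, |P (g z)| < δ := fun z hz => by
    rw [(hball z (hclb (hKF hz).1)).1, abs_mul]
    have h1 : |P z| ≤ δ := (hKF hz).2
    have := abs_nonneg c
    nlinarith
  have hgpre : IsPreconnected (g '' K) :=
    hKpre.image _ fun z hz => (hgd z hz).continuousAt.continuousWithinAt
  have hgV : g '' K ⊆ V := by
    have := hgpre.subset_interior_of_disjoint_frontier (U := V)
      ⟨0, ⟨0, h0K, h0⟩, by rwa [hV.interior_eq]⟩ ?_
    · rwa [hV.interior_eq] at this
    · rw [Set.disjoint_left]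
      rintro _ ⟨z, hz, rfl⟩ hz'
      exact (hgP z hz).not_gt (hδV _ hz')
  have hmap : ∀ z ∈ K, g z ∈ interior K := by
    intro z hz
    have hzV : g z ∈ V := hgV ⟨z, hz, rfl⟩
    have hev : ∀ᶠ x in 𝓝 (g z), x ∈ V ∧ |P x| < δ :=
      (hV.eventually_mem hzV).and ((M.continuousAt (hclε (subset_closure hzV))).abs.eventually_lt_const
        (hgP z hz))
    obtain ⟨η, hη, hη'⟩ := Metric.eventually_nhds_iff_ball.1 hev
    refine mem_interior.2 ⟨Metric.ball (g z) η, ?_, Metric.isOpen_ball, Metric.mem_ball_self hη⟩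
    have hu : IsPreconnected (g '' K ∪ Metric.ball (g z) η) :=
      hgpre.union (g z) ⟨z, hz, rfl⟩ (Metric.mem_ball_self hη) (convex_ball _ _).isPreconnected
    refine Set.subset_union_right.trans (hu.subset_connectedComponentIn (Or.inl ⟨0, h0K, h0⟩) ?_)
    rintro x (⟨y, hy, rfl⟩ | hx)
    · exact ⟨subset_closure (hgV ⟨y, hy, rfl⟩), (hgP y hy).le⟩
    · exact ⟨subset_closure (hη' x hx).1, (hη' x hx).2.le⟩
  exact M.not_norm_deriv_lt_one hg h0 hc hP (norm_deriv_lt_one_of_mapsTo_interior hKc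
    (by simpa [h0] using hmap 0 h0K) hgd h0 hmap)

/-- If `c = -1`, take a small filled neighbourhood `K` of `0` on whose connected boundary `P` has
constant sign. On the boundary of `g K` the function `P` has the opposite sign, so the two boundaries
do not meet; hence one of `K` and `g K` lies inside the other, and `g` or its inverse is a
contraction. -/
lemma ne_neg_one (M : FlatModel P ε) (hg : AnalyticAt ℂ g 0) (h0 : g 0 = 0)
    (hd : deriv g 0 ≠ 0) (hP : ∀ᶠ z in 𝓝 (0 : ℂ), P (g z) = c * P z) : c ≠ -1 := by
  rintro rfl
  obtain ⟨k, hk, hk0, hkd, hgk, hkg⟩ := exists_analytic_inverse hg h0 hd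
  have hk' := tendsto_zero_of_analyticAt hk hk0
  have hkP : ∀ᶠ z in 𝓝 (0 : ℂ), P (k z) = (-1) * P z := by
    filter_upwards [hgk, hk'.eventually hP] with z h1 h2
    rw [h1] at h2
    linarith
  obtain ⟨r₁, hr₁, hball₁⟩ := Metric.eventually_nhds_iff_ball.1
    (hgk.and hk.eventually_analyticAt)
  obtain ⟨r₀, hr₀, hball⟩ := Metric.eventually_nhds_iff_ball.1
    ((hP.and hkg).and (hg.eventually_analyticAt.and
      (((tendsto_zero_of_analyticAt hg h0).eventually (Metric.ball_mem_nhds _ hr₁)).and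
        M.ball_mem)))
  have hr : 0 < min (min r₀ r₁) ε / 2 := by have := M.pos; positivity
  have hrε : min (min r₀ r₁) ε / 2 < ε := by
    have := min_le_right (min r₀ r₁) ε; have := M.pos; linarith
  have hrr : min (min r₀ r₁) ε / 2 < r₀ := by
    have := (min_le_left (min r₀ r₁) ε).trans (min_le_left _ _); linarith
  have hrr₁ : min (min r₀ r₁) ε / 2 < r₁ := by
    have := (min_le_left (min r₀ r₁) ε).trans (min_le_right _ _); linarith
  set r := min (min r₀ r₁) ε / 2 with hrdef
  obtain ⟨V, hV, h0V, hVr, hVz⟩ := M.exists_isOpen_frontier_ne_zero hr hrε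
  obtain ⟨K, hKc, hKpre, h0K, hKfr, hKV, hKr⟩ := exists_filled hV h0V hr hVr
  have hKz : ∀ z ∈ frontier K, P z ≠ 0 := fun z hz => hVz z (hKV hz)
  have hfK : frontier K ⊆ K := hKc.isClosed.frontier_subset
  have hKb : ∀ z ∈ K, z ∈ Metric.ball (0 : ℂ) r₀ := fun z hz =>
    Metric.closedBall_subset_ball hrr (hKr hz)
  have hKb₁ : ∀ z ∈ K, z ∈ Metric.ball (0 : ℂ) r₁ := fun z hz =>
    Metric.closedBall_subset_ball hrr₁ (hKr hz)
  have hgd : ∀ z ∈ K, DifferentiableAt ℂ g z := fun z hz => (hball z (hKb z hz)).2.1.differentiableAt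
  have hgc : ContinuousOn g K := fun z hz => (hgd z hz).continuousAt.continuousWithinAt
  have hgPz : ∀ z ∈ K, P (g z) = -P z := fun z hz => by
    rw [(hball z (hKb z hz)).1.1]; ring
  have hgKc : IsCompact (g '' K) := hKc.image_of_continuousOn hgc
  have hgKpre : IsPreconnected (g '' K) := hKpre.image _ hgc
  -- `g` maps the interior of `K` onto an open set, its inverse being continuous
  have hgo : g '' interior K ⊆ interior (g '' K) := by
    rintro _ ⟨z, hz, rfl⟩
    have hzK := interior_subset hz
    have hb := hball z (hKb z hzK)
    have hb₁ := hball₁ _ hb.2.2.1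
    rw [mem_interior_iff_mem_nhds]
    have hkc : ContinuousAt k (g z) := hb₁.2.continuousAt
    have h1 : ∀ᶠ x in 𝓝 (g z), k x ∈ interior K := by
      refine hkc.eventually_mem (isOpen_interior.mem_nhds ?_)
      rwa [hb.1.2]
    filter_upwards [h1, Metric.isOpen_ball.mem_nhds hb.2.2.1] with x hx hx'
    exact ⟨k x, interior_subset hx, (hball₁ x hx').1⟩
  have hfg : frontier (g '' K) ⊆ g '' frontier K := by
    intro y hy
    obtain ⟨z, hz, rfl⟩ := hgKc.isClosed.frontier_subset hy
    refine ⟨z, ?_, rfl⟩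
    by_contra hnf
    have hzi : z ∈ interior K := by
      by_contra hzi
      exact hnf ⟨subset_closure hz, hzi⟩
    exact hy.2 (hgo ⟨z, hzi, rfl⟩)
  have h0gi : (0 : ℂ) ∈ interior (g '' K) := hgo ⟨0, h0K, h0⟩
  have hgfpre : IsPreconnected (g '' frontier K) := hKfr.image _ (hgc.mono hfK)
  have hsign : Disjoint (g '' frontier K) (frontier K) := by
    rw [Set.disjoint_left]
    rintro _ ⟨z, hz, rfl⟩ hz'
    have hPc : ContinuousOn P (frontier K) := fun x hx =>
      (M.continuousAt ((hball x (hKb x (hfK hx))).2.2.2)).continuousWithinAt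
    have h1 := hgPz z (hfK hz)
    have hpre := hKfr.image P hPc
    have hord : (P '' frontier K).OrdConnected := hpre.ordConnected
    have hmem : ∀ {x y : ℂ}, x ∈ frontier K → y ∈ frontier K → P x ≤ 0 → 0 ≤ P y → False := by
      intro x y hx hy h2 h3
      obtain ⟨w, hw, hw0⟩ := hord.out ⟨x, hx, rfl⟩ ⟨y, hy, rfl⟩ ⟨h2, h3⟩
      exact hKz w hw hw0
    rcases le_total (P z) 0 with h | h
    · exact hmem hz hz' h (by rw [h1]; linarith)
    · exact hmem hz' hz (by rw [h1]; linarith) h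
  by_cases hA : Disjoint (g '' K) (frontier K)
  · have h1 := hgKpre.subset_interior_of_disjoint_frontier (U := K)
      ⟨0, ⟨0, interior_subset h0K, h0⟩, h0K⟩ hA
    exact M.not_norm_deriv_lt_one hg h0 (by norm_num) hP (norm_deriv_lt_one_of_mapsTo_interior hKc
      h0K hgd h0 fun z hz => h1 ⟨z, hz, rfl⟩)
  by_cases hB : Disjoint K (g '' frontier K)
  · have h1 := hKpre.subset_interior_of_disjoint_frontier (U := g '' K)
      ⟨0, interior_subset h0K, h0gi⟩ (hB.mono_right hfg)
    refine M.not_norm_deriv_lt_one hk hk0 (c := -1) (by norm_num) hkP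
      (norm_deriv_lt_one_of_mapsTo_interior hKc h0K (fun z hz =>
        (hball₁ z (hKb₁ z hz)).2.differentiableAt) hk0 fun z hz => ?_)
    obtain ⟨y, hy, rfl⟩ := interior_subset (h1 hz)
    rw [(hball y (hKb y hy)).1.2]
    by_contra hyi
    exact Set.disjoint_left.1 hB hz ⟨y, ⟨subset_closure hy, hyi⟩, rfl⟩
  -- otherwise each boundary lies inside the other set, and the union would be open and compact
  exfalso
  rw [Set.not_disjoint_iff] at hA hB
  obtain ⟨a, ha, haK⟩ := hA
  obtain ⟨b, hb, hbK⟩ := hB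
  have hint : ∀ {x : ℂ} {S : Set ℂ}, x ∈ S → x ∉ frontier S → x ∈ interior S := by
    intro x S hx hxf
    by_contra h
    exact hxf ⟨subset_closure hx, h⟩
  have h1 : frontier K ⊆ interior (g '' K) :=
    hKfr.subset_interior_of_disjoint_frontier
      ⟨a, haK, hint ha fun h => Set.disjoint_left.1 hsign (hfg h) haK⟩ (hsign.symm.mono_right hfg)
  have h2 : g '' frontier K ⊆ interior K :=
    hgfpre.subset_interior_of_disjoint_frontier
      ⟨b, hbK, hint hb (Set.disjoint_left.1 hsign hbK)⟩ hsign
  have hun : K ∪ g '' K = interior K ∪ interior (g '' K) := by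
    refine Set.Subset.antisymm ?_ (Set.union_subset_union interior_subset interior_subset)
    have h3 : ∀ x ∈ K, x ∈ interior K ∪ interior (g '' K) := fun x hx => by
      by_cases hxf : x ∈ frontier K
      · exact Or.inr (h1 hxf)
      · exact Or.inl (hint hx hxf)
    rintro x (hx | hx)
    · exact h3 x hx
    · by_cases hxf : x ∈ frontier (g '' K)
      · exact Or.inl (h2 (hfg hxf))
      · exact Or.inr (hint hx hxf)
  have hclopen : IsClopen (K ∪ g '' K) :=
    ⟨(hKc.union hgKc).isClosed, by rw [hun]; exact isOpen_interior.union isOpen_interior⟩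
  rcases isClopen_iff.1 hclopen with h | h
  · exact (h.le (Or.inl (interior_subset h0K)) : (0 : ℂ) ∈ (∅ : Set ℂ))
  · exact noncompact_univ ℂ (h ▸ hKc.union hgKc)

/-- A local biholomorphism of the plane that multiplies `P` by a constant preserves `P`. -/
theorem eq_one_of_comp_eq_mul (M : FlatModel P ε) (hg : AnalyticAt ℂ g 0) (h0 : g 0 = 0)
    (hd : deriv g 0 ≠ 0) (hc : c ≠ 0) (hP : ∀ᶠ z in 𝓝 (0 : ℂ), P (g z) = c * P z) :
    c = 1 ∧ ‖deriv g 0‖ = 1 := by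
  obtain ⟨k, hk, hk0, hkd, hgk, -⟩ := exists_analytic_inverse hg h0 hd
  have hkP : ∀ᶠ z in 𝓝 (0 : ℂ), P (k z) = c⁻¹ * P z := by
    filter_upwards [hgk, (tendsto_zero_of_analyticAt hk hk0).eventually hP] with z h1 h2
    rw [h1] at h2
    rw [h2, inv_mul_cancel_left₀ hc]
  have h1 := M.not_norm_deriv_lt_one hg h0 hc hP
  have h2 := M.not_norm_deriv_lt_one hk hk0 (inv_ne_zero hc) hkP
  have h3 := M.not_abs_lt_one hg h0 hc hP
  have h4 := M.not_abs_lt_one hk hk0 (inv_ne_zero hc) hkP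
  rw [hkd, norm_inv, inv_lt_one_iff₀] at h2
  rw [abs_inv, inv_lt_one_iff₀] at h4
  push Not at h1 h2 h3 h4
  refine ⟨?_, le_antisymm h2.2 h1⟩
  rcases abs_eq (zero_le_one (α := ℝ)) |>.1 (le_antisymm h4.2 h3) with h | h
  · exact h
  · exact absurd h (M.ne_neg_one hg h0 hd hP)

end FlatModel

/-! ### Automorphisms of the hypersurface -/

lemma isBiholomorphicNearZero_prod {g : ℂ → ℂ} (hg : AnalyticAt ℂ g 0)
    (hd : deriv g 0 ≠ 0) : IsBiholomorphicNearZero fun p : ℂ × ℂ => (p.1, g p.2) := by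
  have hs := hg.hasStrictDerivAt.hasStrictFDerivAt_equiv hd
  set R := hs.toOpenPartialHomeomorph g with hR
  have hRg : ⇑R = g := hs.toOpenPartialHomeomorph_coe
  have h0R : (0 : ℂ) ∈ R.source := hs.mem_toOpenPartialHomeomorph_source
  have hsymm : AnalyticAt ℂ R.symm (R 0) := by
    rw [hRg]
    exact hg.analyticAt_localInverse hd
  set S : Set ℂ := {z | AnalyticAt ℂ g z} ∩ (R.source ∩ R ⁻¹' {y | AnalyticAt ℂ R.symm y}) with hSdef
  have hS : IsOpen S := (isOpen_analyticAt ℂ g).inter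
    (R.isOpen_inter_preimage (isOpen_analyticAt ℂ R.symm))
  have h0S : (0 : ℂ) ∈ S := ⟨hg, h0R, hsymm⟩
  refine ⟨(OpenPartialHomeomorph.refl ℂ).prod (R.restrOpen S hS), ⟨trivial, h0R, h0S⟩, ?_, ?_, ?_⟩
  · intro p hp
    have h1 : AnalyticAt ℂ g p.2 := hp.2.2.1
    refine DifferentiableAt.differentiableWithinAt ?_
    change DifferentiableAt ℂ (fun p : ℂ × ℂ => (p.1, R p.2)) p
    rw [hRg]
    exact differentiableAt_fst.prodMk
      (DifferentiableAt.comp (g := g) p h1.differentiableAt differentiableAt_snd)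
  · intro p hp
    have h1 : p.2 ∈ R.target := hp.2.1
    have h2 : AnalyticAt ℂ R.symm (R (R.symm p.2)) := hp.2.2.2.2
    rw [R.right_inv h1] at h2
    refine DifferentiableAt.differentiableWithinAt ?_
    change DifferentiableAt ℂ (fun p : ℂ × ℂ => (p.1, R.symm p.2)) p
    exact differentiableAt_fst.prodMk
      (DifferentiableAt.comp (g := R.symm) p h2.differentiableAt differentiableAt_snd)
  · refine Eventually.of_forall fun p => ?_
    change (p.1, g p.2) = (p.1, R p.2)
    rw [hRg]

lemma G₂_subset_stabilityGroup {ε : ℝ} (hε : 0 < ε) (P : ℂ → ℝ) :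
    G₂ P ⊆ stabilityGroup (model ε P) := by
  rintro F ⟨g, hg, h0, hd, hP, rfl⟩
  have hd' : deriv g 0 ≠ 0 := by
    intro h
    simp [h] at hd
  refine ⟨_, rfl, by simp [h0], isBiholomorphicNearZero_prod hg hd', ?_⟩
  have hsnd : Tendsto (fun p : ℂ × ℂ => p.2) (𝓝 0) (𝓝 0) := continuous_snd.tendsto (0 : ℂ × ℂ)
  filter_upwards [hsnd.eventually hP, hsnd.eventually
    ((tendsto_zero_of_analyticAt hg h0).eventually_mem (Metric.ball_mem_nhds _ hε))]
    with p h1 h2 hp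
  refine ⟨h2, ?_⟩
  change p.1.re + P (g p.2) = 0
  rw [h1]
  exact hp.2

/-- The Jacobian determinant of a map of `ℂ²`. -/
noncomputable def jacobian (f₁ f₂ : ℂ × ℂ → ℂ) (p : ℂ × ℂ) : ℂ :=
  dFst f₁ p * dSnd f₂ p - dSnd f₁ p * dFst f₂ p

lemma fderiv_apply_eq {e : ℂ × ℂ → ℂ × ℂ} {p : ℂ × ℂ} (he : DifferentiableAt ℂ e p) (a b : ℂ) :
    fderiv ℂ e p (a, b) =
      (a * dFst (fun p => (e p).1) p + b * dSnd (fun p => (e p).1) p,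
        a * dFst (fun p => (e p).2) p + b * dSnd (fun p => (e p).2) p) := by
  have hL := he.hasFDerivAt
  have e1 : HasDerivAt (fun w => e (w, p.2)) (fderiv ℂ e p (1, 0)) p.1 :=
    HasFDerivAt.comp_hasDerivAt (l := e) (f := fun w => (w, p.2)) p.1 hL
      ((hasDerivAt_id p.1).prodMk (hasDerivAt_const p.1 p.2))
  have e2 : HasDerivAt (fun z => e (p.1, z)) (fderiv ℂ e p (0, 1)) p.2 :=
    HasFDerivAt.comp_hasDerivAt (l := e) (f := fun z => (p.1, z)) p.2 hL
      ((hasDerivAt_const p.2 p.1).prodMk (hasDerivAt_id p.2))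
  have d11 : dFst (fun p => (e p).1) p = (fderiv ℂ e p (1, 0)).1 :=
    ((ContinuousLinearMap.fst ℂ ℂ ℂ).hasFDerivAt.comp_hasDerivAt p.1 e1).deriv
  have d12 : dFst (fun p => (e p).2) p = (fderiv ℂ e p (1, 0)).2 :=
    ((ContinuousLinearMap.snd ℂ ℂ ℂ).hasFDerivAt.comp_hasDerivAt p.1 e1).deriv
  have d21 : dSnd (fun p => (e p).1) p = (fderiv ℂ e p (0, 1)).1 :=
    ((ContinuousLinearMap.fst ℂ ℂ ℂ).hasFDerivAt.comp_hasDerivAt p.2 e2).deriv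
  have d22 : dSnd (fun p => (e p).2) p = (fderiv ℂ e p (0, 1)).2 :=
    ((ContinuousLinearMap.snd ℂ ℂ ℂ).hasFDerivAt.comp_hasDerivAt p.2 e2).deriv
  have h : ((a, b) : ℂ × ℂ) = a • (1, 0) + b • (0, 1) := by simp
  rw [h, map_add, map_smul, map_smul, d11, d12, d21, d22]
  rfl

lemma jacobian_ne_zero {e : OpenPartialHomeomorph (ℂ × ℂ) (ℂ × ℂ)}
    (he : DifferentiableOn ℂ e e.source) (he' : DifferentiableOn ℂ e.symm e.target) {p : ℂ × ℂ}
    (hp : p ∈ e.source) : jacobian (fun p => (e p).1) (fun p => (e p).2) p ≠ 0 := by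
  have hd : DifferentiableAt ℂ e p := he.differentiableAt (e.open_source.mem_nhds hp)
  have hd' : DifferentiableAt ℂ e.symm (e p) :=
    he'.differentiableAt (e.open_target.mem_nhds (e.map_source hp))
  have hinj : ∀ v, fderiv ℂ e p v = 0 → v = 0 := by
    intro v hv
    have h1 : HasFDerivAt (e.symm ∘ e) ((fderiv ℂ e.symm (e p)).comp (fderiv ℂ e p)) p :=
      hd'.hasFDerivAt.comp p hd.hasFDerivAt
    have h2 : HasFDerivAt (e.symm ∘ e) (ContinuousLinearMap.id ℂ (ℂ × ℂ)) p := by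
      refine (hasFDerivAt_id p).congr_of_eventuallyEq ?_
      filter_upwards [e.open_source.mem_nhds hp] with q hq
      exact e.left_inv hq
    have h3 := congrArg (fun L => L v) (h1.unique h2)
    simpa [hv] using h3.symm
  intro hJ
  rw [jacobian] at hJ
  set α := dFst (fun p => (e p).1) p with hα
  set β := dSnd (fun p => (e p).1) p with hβ
  set γ := dFst (fun p => (e p).2) p with hγ
  set δ := dSnd (fun p => (e p).2) p with hδ
  have h1 := hinj (δ, -γ) (by
    rw [fderiv_apply_eq hd]
    refine Prod.ext ?_ ?_
    · change δ * α + -γ * β = 0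
      linear_combination hJ
    · change δ * γ + -γ * δ = 0
      ring)
  have h2 := hinj (-β, α) (by
    rw [fderiv_apply_eq hd]
    refine Prod.ext ?_ ?_
    · change -β * α + α * β = 0
      ring
    · change -β * γ + α * δ = 0
      linear_combination hJ)
  simp only [Prod.mk_eq_zero, neg_eq_zero] at h1 h2
  have h3 := hinj (1, 0) (by
    rw [fderiv_apply_eq hd, ← hα, ← hβ, ← hγ, ← hδ, h1.2, h2.2]
    simp)
  simp at h3

namespace FlatModel
variable {P : ℂ → ℝ} {ε : ℝ}

/-- The parametrization of the hypersurface as a graph over `ℝ × ℂ`. -/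
lemma hasFDerivAt_graph (M : FlatModel P ε) (t : ℝ) {z : ℂ} (hz : z ∈ Metric.ball (0 : ℂ) ε) :
    ∃ L : ℝ × ℂ →L[ℝ] ℂ × ℂ,
      HasFDerivAt (fun q : ℝ × ℂ => ((q.1 * Complex.I - P q.2 : ℂ), q.2)) L (t, z) ∧
      ∀ (τ : ℝ) (ζ : ℂ), L (τ, ζ) = (τ * Complex.I - (fderiv ℝ P z ζ : ℝ), ζ) := by
  have h1 : HasFDerivAt (fun q : ℝ × ℂ => ((q.1 : ℂ) * Complex.I))
      ((ContinuousLinearMap.fst ℝ ℝ ℂ).smulRight Complex.I) (t, z) := by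
    have := (ContinuousLinearMap.smulRight (ContinuousLinearMap.fst ℝ ℝ ℂ)
      Complex.I).hasFDerivAt (x := (t, z))
    refine this.congr_of_eventuallyEq (Eventually.of_forall fun q => ?_)
    simp
  have h2 : HasFDerivAt (fun q : ℝ × ℂ => ((P q.2 : ℝ) : ℂ))
      (Complex.ofRealCLM.comp ((fderiv ℝ P z).comp (ContinuousLinearMap.snd ℝ ℝ ℂ))) (t, z) :=
    Complex.ofRealCLM.hasFDerivAt.comp (t, z) (HasFDerivAt.comp (g := P) (t, z) (M.hasFDerivAt hz)
      hasFDerivAt_snd)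
  refine ⟨_, (h1.sub h2).prodMk hasFDerivAt_snd, fun τ ζ => ?_⟩
  simp

/-- The pullback `(De)⁻¹ (i, 0)` of the translation field by a map preserving the hypersurface is
tangent to it: `De` carries tangent vectors to tangent vectors, and hence, by counting dimensions,
transversal vectors to transversal ones. -/
lemma re_add_fderiv_eq_zero_of_map (M : FlatModel P ε) {e : ℂ × ℂ → ℂ × ℂ} {t : ℝ} {z : ℂ}
    (hz : z ∈ Metric.ball (0 : ℂ) ε)
    (he : DifferentiableAt ℂ e ((t * Complex.I - P z : ℂ), z))
    (hez : (e ((t * Complex.I - P z : ℂ), z)).2 ∈ Metric.ball (0 : ℂ) ε)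
    (hM : ∀ᶠ q in 𝓝 (t, z), (e ((q.1 * Complex.I - P q.2 : ℂ), q.2)).1.re +
      P (e ((q.1 * Complex.I - P q.2 : ℂ), q.2)).2 = 0) {y : ℂ × ℂ}
    (hy : fderiv ℂ e ((t * Complex.I - P z : ℂ), z) y = (Complex.I, 0)) :
    y.1.re + fderiv ℝ P z y.2 = 0 := by
  obtain ⟨L, hL, hLapp⟩ := M.hasFDerivAt_graph t hz
  set p : ℂ × ℂ := ((t * Complex.I - P z : ℂ), z) with hp
  set D := fderiv ℂ e p with hD
  -- the differential of the defining function at the image point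
  set ψ : ℂ × ℂ → ℝ := fun v => (D v).1.re + fderiv ℝ P (e p).2 (D v).2 with hψ
  have hψadd : ∀ v w, ψ (v + w) = ψ v + ψ w := fun v w => by
    simp only [hψ, map_add, Prod.fst_add, Prod.snd_add, Complex.add_re]
    ring
  have hψsmul : ∀ (s : ℝ) v, ψ ((s : ℂ) • v) = s * ψ v := fun s v => by
    simp only [hψ, map_smul, Prod.smul_fst, Prod.smul_snd, smul_eq_mul, Complex.re_ofReal_mul]
    rw [← Complex.real_smul, map_smul, smul_eq_mul]
    ring
  have hder : HasFDerivAt (fun q : ℝ × ℂ => (e ((q.1 * Complex.I - P q.2 : ℂ), q.2)).1.re +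
      P (e ((q.1 * Complex.I - P q.2 : ℂ), q.2)).2)
      ((Complex.reCLM.comp (ContinuousLinearMap.fst ℝ ℂ ℂ) +
        (fderiv ℝ P (e p).2).comp (ContinuousLinearMap.snd ℝ ℂ ℂ)).comp
        ((D.restrictScalars ℝ).comp L)) (t, z) := by
    have h1 : HasFDerivAt (fun q : ℝ × ℂ => e ((q.1 * Complex.I - P q.2 : ℂ), q.2))
        ((D.restrictScalars ℝ).comp L) (t, z) :=
      HasFDerivAt.comp (g := e) (t, z) (he.hasFDerivAt.restrictScalars ℝ) hL
    have h2 : HasFDerivAt (fun v : ℂ × ℂ => v.1.re + P v.2)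
        (Complex.reCLM.comp (ContinuousLinearMap.fst ℝ ℂ ℂ) +
        (fderiv ℝ P (e p).2).comp (ContinuousLinearMap.snd ℝ ℂ ℂ)) (e p) :=
      (Complex.reCLM.hasFDerivAt.comp (e p) hasFDerivAt_fst).add
        (HasFDerivAt.comp (g := P) (e p) (M.hasFDerivAt hez) hasFDerivAt_snd)
    exact HasFDerivAt.comp (g := fun v : ℂ × ℂ => v.1.re + P v.2) (t, z) h2 h1
  have hzero := hder.unique ((hasFDerivAt_const (0 : ℝ) (t, z)).congr_of_eventuallyEq hM)
  have hψtan : ∀ (τ : ℝ) (ζ : ℂ), ψ (τ * Complex.I - (fderiv ℝ P z ζ : ℝ), ζ) = 0 := fun τ ζ => by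
    have := congrArg (fun T => T (τ, ζ)) hzero
    simpa [hLapp, hψ] using this
  have hψall : ∀ v : ℂ × ℂ, ψ v = (v.1.re + fderiv ℝ P z v.2) * ψ (1, 0) := by
    intro v
    have hv : v = ((v.1.re + fderiv ℝ P z v.2 : ℝ) : ℂ) • ((1, 0) : ℂ × ℂ) +
        ((v.1.im : ℂ) * Complex.I - (fderiv ℝ P z v.2 : ℝ), v.2) := by
      refine Prod.ext ?_ (by simp)
      apply Complex.ext <;> simp
    conv_lhs => rw [hv]
    rw [hψadd, hψsmul, hψtan, add_zero]
  have h1 : ψ y = 0 := by simp [hψ, hy]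
  have h2 : ψ ((-Complex.I) • y) = 1 := by simp [hψ, hy]
  have h3 : ψ (1, 0) ≠ 0 := fun h => by
    rw [hψall, h, mul_zero] at h2
    exact zero_ne_one h2
  rw [hψall] at h1
  exact (mul_eq_zero.1 h1).resolve_right h3

/-- Once the pullback of the translation field is a constant multiple of it, an automorphism has the
form `(z₁ / c + a z₂, g z₂)`; flatness gives `a = 0`, and `g` multiplies `P` by `c⁻¹`. -/
theorem stabilityGroup_subset_G₂ (M : FlatModel P ε) (hrot : ¬ RotationallySymmetricable P) :
    stabilityGroup (model ε P) ⊆ G₂ P := by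
  rintro F ⟨f, rfl, hf0, ⟨e, h0e, he, he', hfe⟩, hfM⟩
  have he0 : e 0 = 0 := by rw [← hfe.self_of_nhds, hf0]
  have hopen := e.open_source
  have hdiff : ∀ p ∈ e.source, DifferentiableAt ℂ e p := fun p hp =>
    he.differentiableAt (hopen.mem_nhds hp)
  set e₁ : ℂ × ℂ → ℂ := fun p => (e p).1 with he₁
  set e₂ : ℂ × ℂ → ℂ := fun p => (e p).2 with he₂
  have hs₁ : SepHolOn e₁ e.source := sepHolOn_of_differentiableOn hopen he.fst
  have hs₂ : SepHolOn e₂ e.source := sepHolOn_of_differentiableOn hopen he.snd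
  have hJ : ∀ p ∈ e.source, jacobian e₁ e₂ p ≠ 0 := fun p hp => jacobian_ne_zero he he' hp
  have hJs : SepHolOn (jacobian e₁ e₂) e.source :=
    ((hs₁.dFst hopen).mul (hs₂.dSnd hopen)).sub ((hs₁.dSnd hopen).mul (hs₂.dFst hopen))
  -- the pullback of the translation field
  set Y₁ : ℂ × ℂ → ℂ := fun p => Complex.I * dSnd e₂ p / jacobian e₁ e₂ p with hY₁
  set Y₂ : ℂ × ℂ → ℂ := fun p => -Complex.I * dFst e₂ p / jacobian e₁ e₂ p with hY₂
  have hY : ∀ p ∈ e.source, fderiv ℂ e p (Y₁ p, Y₂ p) = (Complex.I, 0) := by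
    intro p hp
    rw [fderiv_apply_eq (hdiff p hp)]
    have h1 := hJ p hp
    refine Prod.ext ?_ ?_
    · change Y₁ p * dFst e₁ p + Y₂ p * dSnd e₁ p = Complex.I
      simp only [hY₁, hY₂]
      rw [div_mul_eq_mul_div, div_mul_eq_mul_div, ← add_div, div_eq_iff h1, jacobian]
      ring
    · change Y₁ p * dFst e₂ p + Y₂ p * dSnd e₂ p = 0
      simp only [hY₁, hY₂]
      ring
  have hgraph : Tendsto (fun q : ℝ × ℂ => (((q.1 : ℂ) * Complex.I - P q.2 : ℂ), q.2)) (𝓝 0)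
      (𝓝 0) := by
    obtain ⟨L, hL, -⟩ := M.hasFDerivAt_graph 0 (Metric.mem_ball_self M.pos)
    have := hL.continuousAt.tendsto
    simpa [M.apply_zero, Prod.zero_eq_mk] using this
  have hsnd : Tendsto (fun q : ℝ × ℂ => q.2) (𝓝 0) (𝓝 0) := continuous_snd.tendsto (0 : ℝ × ℂ)
  have hMe : ∀ᶠ q in 𝓝 (0 : ℝ × ℂ), e ((q.1 * Complex.I - P q.2 : ℂ), q.2) ∈ model ε P := by
    filter_upwards [hgraph.eventually hfM, hgraph.eventually hfe, hsnd.eventually M.ball_mem]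
      with q h1 h2 h3
    rw [← h2]
    exact h1 ⟨h3, by simp⟩
  have htan : ∀ᶠ q in 𝓝 (0 : ℝ × ℂ), (Y₁ (q.1 * Complex.I - P q.2, q.2)).re +
      fderiv ℝ P q.2 (Y₂ (q.1 * Complex.I - P q.2, q.2)) = 0 := by
    filter_upwards [hMe.eventually_nhds, hgraph.eventually_mem (hopen.mem_nhds h0e),
      hsnd.eventually M.ball_mem] with q h1 h2 h3
    exact M.re_add_fderiv_eq_zero_of_map (t := q.1) (z := q.2) h3 (hdiff _ h2) h1.self_of_nhds.1
      (h1.mono fun q' hq' => hq'.2) (hY _ h2)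
  obtain ⟨c, hc⟩ := M.tangent_rigidity hrot (hopen.mem_nhds h0e)
    (((hs₂.dSnd hopen).const_mul Complex.I).div hJs hJ)
    (((hs₂.dFst hopen).const_mul (-Complex.I)).div hJs hJ) htan
  obtain ⟨r, hr, hball⟩ := Metric.eventually_nhds_iff_ball.1 (hc.and (hopen.mem_nhds h0e))
  have hcI : ∀ p ∈ Metric.ball (0 : ℂ × ℂ) r, c * dFst e₁ p = 1 ∧ dFst e₂ p = 0 := by
    intro p hp
    obtain ⟨⟨h1, h2⟩, h3⟩ := hball p hp
    have h4 := hY p h3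
    have h1' : Y₁ p = c * Complex.I := h1
    have h2' : Y₂ p = 0 := h2
    rw [h1', h2', fderiv_apply_eq (hdiff p h3)] at h4
    have h5 : c * Complex.I * dFst e₁ p + 0 * dSnd e₁ p = Complex.I := congrArg Prod.fst h4
    refine ⟨mul_right_cancel₀ Complex.I_ne_zero (by linear_combination h5), ?_⟩
    rw [div_eq_zero_iff] at h2
    simpa using h2.resolve_right (hJ p h3)
  have h0r : (0 : ℂ × ℂ) ∈ Metric.ball (0 : ℂ × ℂ) r := Metric.mem_ball_self hr
  have hc0 : c ≠ 0 := by
    rintro rfl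
    have := (hcI 0 h0r).1
    simp at this
  set a : ℂ → ℂ := fun z => e₁ (0, z) with ha
  set g : ℂ → ℂ := fun z => e₂ (0, z) with hg
  have hform : ∀ p ∈ Metric.ball (0 : ℂ × ℂ) r, e p = ((c : ℂ)⁻¹ * p.1 + a p.2, g p.2) := by
    intro p hp
    have hp' : ‖p.1‖ < r ∧ ‖p.2‖ < r := max_lt_iff.1 (mem_ball_zero_iff.1 hp)
    have hmem : ∀ w ∈ Metric.ball (0 : ℂ) r, (w, p.2) ∈ Metric.ball (0 : ℂ × ℂ) r := fun w hw =>
      mem_ball_zero_iff.2 (max_lt (mem_ball_zero_iff.1 hw) hp'.2)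
    have h0w : (0 : ℂ) ∈ Metric.ball (0 : ℂ) r := Metric.mem_ball_self hr
    have hpw : p.1 ∈ Metric.ball (0 : ℂ) r := mem_ball_zero_iff.2 hp'.1
    have hpre : IsPreconnected (Metric.ball (0 : ℂ) r) := (convex_ball _ _).isPreconnected
    have d₁ : ∀ w ∈ Metric.ball (0 : ℂ) r, HasDerivAt (fun w => e₁ (w, p.2) - (c : ℂ)⁻¹ * w) 0 w := by
      intro w hw
      have h1 := (hs₁.fst _ (hball _ (hmem w hw)).2).hasDerivAt
      have h2 : dFst e₁ (w, p.2) = (c : ℂ)⁻¹ :=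
        eq_inv_of_mul_eq_one_right (hcI _ (hmem w hw)).1
      have h3 := h1.sub ((hasDerivAt_id w).const_mul (c : ℂ)⁻¹)
      rw [mul_one] at h3
      refine h3.congr_deriv ?_
      exact sub_eq_zero.2 h2
    have d₂ : ∀ w ∈ Metric.ball (0 : ℂ) r, HasDerivAt (fun w => e₂ (w, p.2)) 0 w := by
      intro w hw
      have h1 := (hs₂.fst _ (hball _ (hmem w hw)).2).hasDerivAt
      exact h1.congr_deriv (hcI _ (hmem w hw)).2
    have k₁ := Metric.isOpen_ball.is_const_of_deriv_eq_zero hpre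
      (fun w hw => (d₁ w hw).differentiableAt.differentiableWithinAt)
      (fun w hw => (d₁ w hw).deriv) hpw h0w
    have k₂ := Metric.isOpen_ball.is_const_of_deriv_eq_zero hpre
      (fun w hw => (d₂ w hw).differentiableAt.differentiableWithinAt)
      (fun w hw => (d₂ w hw).deriv) hpw h0w
    refine Prod.ext ?_ k₂
    change e₁ p = (c : ℂ)⁻¹ * p.1 + e₁ (0, p.2)
    have k₁' : e₁ (p.1, p.2) - (c : ℂ)⁻¹ * p.1 = e₁ (0, p.2) - (c : ℂ)⁻¹ * 0 := k₁
    rw [Prod.mk.eta] at k₁'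
    linear_combination k₁'
  have hslice : ∀ {u : ℂ × ℂ → ℂ}, SepHolOn u e.source → AnalyticAt ℂ (fun z => u (0, z)) 0 := by
    intro u hu
    refine DifferentiableOn.analyticAt (s := Metric.ball 0 r) (fun z hz => ?_)
      (Metric.ball_mem_nhds _ hr)
    have hm : ((0 : ℂ), z) ∈ Metric.ball (0 : ℂ × ℂ) r :=
      mem_ball_zero_iff.2 (max_lt (by simpa using hr) (mem_ball_zero_iff.1 hz))
    exact (hu.snd _ (hball _ hm).2).differentiableWithinAt
  have haan : AnalyticAt ℂ a 0 := hslice hs₁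
  have hgan : AnalyticAt ℂ g 0 := hslice hs₂
  have ha0 : a 0 = 0 := congrArg Prod.fst he0
  have hg0 : g 0 = 0 := congrArg Prod.snd he0
  have hgd : deriv g 0 ≠ 0 := by
    intro h
    have h1 : dSnd e₂ 0 = 0 := h
    have h2 := hJ 0 h0e
    rw [jacobian, h1, (hcI 0 h0r).2] at h2
    simp at h2
  have hrel : ∀ᶠ z in 𝓝 (0 : ℂ), P (g z) = c⁻¹ * P z - (a z).re := by
    have h1 : Tendsto (fun z : ℂ => ((0 : ℝ), z)) (𝓝 0) (𝓝 0) := by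
      have : Continuous fun z : ℂ => ((0 : ℝ), z) := by fun_prop
      exact this.tendsto 0
    filter_upwards [h1.eventually hMe,
      h1.eventually (hgraph.eventually_mem (Metric.ball_mem_nhds _ hr))] with z h2 h3
    rw [hform _ h3] at h2
    have h4 := h2.2
    simp only [Complex.ofReal_zero, zero_mul, zero_sub, Complex.add_re] at h4
    rw [← Complex.ofReal_inv, Complex.re_ofReal_mul, Complex.neg_re, Complex.ofReal_re] at h4
    linarith
  have hflat : Flat fun z => (a z).re := by
    intro N
    have h1 := ((M.flat N).const_mul_left c⁻¹).sub ((M.flat.comp_isBigO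
      (tendsto_zero_of_analyticAt hgan hg0) (isBigO_id_of_analyticAt hgan hg0)) N)
    refine h1.congr' ?_ EventuallyEq.rfl
    filter_upwards [hrel] with z hz
    rw [hz]
    ring
  have haz : ∀ᶠ z in 𝓝 (0 : ℂ), a z = 0 := by
    have := (eventually_eq_of_flat_re haan hflat).2
    rwa [ha0] at this
  obtain ⟨hc1, hg1⟩ := M.eq_one_of_comp_eq_mul hgan hg0 hgd (inv_ne_zero hc0)
    (by filter_upwards [hrel, haz] with z h1 h2; rw [h1, h2]; simp)
  refine ⟨g, hgan, hg0, hg1, ?_, Germ.coe_eq.2 ?_⟩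
  · filter_upwards [hrel, haz] with z h1 h2
    rw [h1, h2, hc1]
    simp
  · have hsnd' : Tendsto (fun p : ℂ × ℂ => p.2) (𝓝 0) (𝓝 0) := continuous_snd.tendsto (0 : ℂ × ℂ)
    have hc1' : (c : ℂ)⁻¹ = 1 := by rw [← Complex.ofReal_inv, hc1, Complex.ofReal_one]
    filter_upwards [hfe, Metric.ball_mem_nhds (0 : ℂ × ℂ) hr, hsnd'.eventually haz] with p h1 h2 h3
    rw [h1, hform p h2, h3, hc1', one_mul, add_zero]

end FlatModel

end InfiniteTypeModel

theorem mainTheorem6 (ε : ℝ) (hε : 0 < ε) (P : ℂ → ℝ)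
    (hP : ContDiffOn ℝ ∞ P (Metric.ball (0 : ℂ) ε))
    (hrot : ¬ InfiniteTypeModel.RotationallySymmetricable P)
    (hzero : connectedComponentIn (InfiniteTypeModel.zeroSet ε P) 0 = {0})
    (hinf : connectedComponentIn (InfiniteTypeModel.SInf ε P) 0 = {0}) :
    InfiniteTypeModel.stabilityGroup (InfiniteTypeModel.model ε P) =
      InfiniteTypeModel.G₂ P :=
  Set.Subset.antisymm
    ((InfiniteTypeModel.flatModel_of_connectedComponentIn hε hP hzero
      hinf).stabilityGroup_subset_G₂ hrot)
    (InfiniteTypeModel.G₂_subset_stabilityGroup hε P)
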